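/- Let $d\in\mathbb N$, let $1<p<2$ and $q\ge p$ be real numbers with $\theta:=\frac1p+\frac1q>1$, and put $K:=(1-2^{1-\theta})^{-1}$. Write $\|\cdot\|$ for the Euclidean norm on $\mathbb R^d$ and for the induced operator norm on matrices. For an interval $[a,b]$ let $\|x\|_{\infty,[a,b]}=\sup_{t\in[a,b]}\|x(t)\|$, $$|||x|||_{p\text{-var},[a,b]}:=\Big(\sup_{a\le t_0\le\dots\le t_n\le b}\sum_{i=0}^{n-1}\|x(t_{i+1})-x(t_i)\|^p\Big)^{1/p},\qquad \|x\|_{p\text{-var},[a,b]}:=\|x(a)\|+|||x|||_{p\text{-var},[a,b]},$$ and write $\Delta_k:=[k,k+1]$ for $k=0,1,2,\dots$. Consider on $[0,\infty)$ the Young differential equation $$dx(t)=[A(t)x(t)+F(t,x(t))]\,dt+C(t)x(t)\,d\omega(t),\qquad x(t)\in\mathbb R^d, \tag{1}$$ where $\omega:[0,\infty)\to\mathbb R$ is continuous with finite $p$-variation on every $[0,T]$, $A:[0,\infty)\to\mathbb R^{d\times d}$ is continuous, $C:[0,\infty)\to\mathbb R^{d\times d}$ is continuous with finite $q$-variation on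 every $[0,T]$, and $F:[0,\infty)\times\mathbb R^d\to\mathbb R^d$. A solution of (1) is a continuous path $x:[0,\infty)\to\mathbb R^d$ of finite $q$-variation on every $[0,T]$ such that $s\mapsto A(s)x(s)+F(s,x(s))$ is integrable on every $[0,t]$ and $x(t)=x(0)+\int_0^t[A(s)x(s)+F(s,x(s))]\,ds+\int_0^tC(s)x(s)\,d\omega(s)$ for all $t\ge0$, the last integral being the Young integral, i.e. the limit of the left-point Riemann sums over finite partitions of $[0,t]$ as the mesh tends to $0$. Assume: ($\mathbf H_1$) there is a locally integrable function $h:[0,\infty)\to[0,\infty)$ with $\langle x,A(t)x\rangle\le-h(t)\|x\|^2$ for all $t\ge0$, $x\in\mathbb R^d$; ($\mathbf H_2$) $F(t,0)=0$ for all $t\ge0$, and there is a continuous function $f:[0,\infty)\to[0,\infty)$ with $\|F(t,x)-F(t,y)\|\le f(t)\|x-y\|$ for all $t\ge0$, $x,y\in\mathbb R^d$; ($\mathbf H_3$) $\hat A<\infty$, $\hat C<\infty$ and $\Gamma(\omega,2p+2)<\infty$, where $$\hat A:=\limsup_{m\to\infty}\Big(\tfrac1{m+1}\sum_{k=0}^m\big(\|A\|_{\infty,\Delta_k}+\|f\|_{\infty,\Delta_k}\big)^{4p}\Big)^{\frac1{4p}},\qquad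 \hat C:=\limsup_{m\to\infty}\Big(\tfrac1{m+1}\sum_{k=0}^m\|C\|_{q\text{-var},\Delta_k}^{2p+2}\Big)^{\frac1{2p+2}},$$ $$\Gamma(\omega,r):=\limsup_{m\to\infty}\Big(\tfrac1{m+1}\sum_{k=0}^m|||\omega|||_{p\text{-var},\Delta_k}^{r}\Big)^{\frac1r}\qquad(r>0).$$ Suppose further that $$\liminf_{t\to\infty}\frac1t\int_0^t[h(s)-f(s)]\,ds\ \ge\ h_0>0$$ and $$h_0>K(1+4\hat G)\,\hat C\,\big[\Gamma(\omega,2)+\Gamma(\omega,4)^2+\Gamma(\omega,2p+2)^{p+1}\big],\qquad \hat G:=\max\{8\hat A,\;16K\hat C,\;8^p\hat A^p,\;16^pK^p\hat C^p\}.$$ Then the zero solution of (1) is exponentially stable, that is: $x\equiv0$ is a solution of (1); for every $\varepsilon>0$ there is $r>0$ such that every solution $x$ of (1) with $\|x(0)\|<r$ satisfies $\sup_{t\ge0}\|x(t)\|<\varepsilon$; and there is $r>0$ such that every solution $x$ of (1) with $\|x(0)\|<r$ satisfies $$\limsup_{t\to\infty}\frac1t\log\|x(t)\|<0\qquad(\text{with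 }\log0:=-\infty).$$ -/

import Mathlib

open scoped ENNReal
open Set Filter MeasureTheory

noncomputable section

namespace YoungStability

/-- The Euclidean space `ℝ^d`. -/
abbrev Vec (d : ℕ) : Type := EuclideanSpace ℝ (Fin d)

/-- Real `d × d` matrices as linear operators of Euclidean space; the norm is the operator norm
induced by the Euclidean norm. -/
abbrev Mat (d : ℕ) : Type := Vec d →L[ℝ] Vec d

/-- The `p`-variation seminorm of `x` on the set `s` (used for `s = [a, b]`), with values in
`[0, ∞]`: the supremum over finite sequences `u 0 ≤ u 1 ≤ ⋯ ≤ u n` in `s` of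
`(∑ ‖x (u (i+1)) - x (u i)‖ ^ p) ^ (1/p)`. -/
def pVar {E : Type*} [NormedAddCommGroup E] (p : ℝ) (x : ℝ → E) (s : Set ℝ) : ℝ≥0∞ :=
  (⨆ u : ℕ × {u : ℕ → ℝ // Monotone u ∧ ∀ i, u i ∈ s},
    ∑ i ∈ Finset.range u.1, ‖x (u.2.1 (i + 1)) - x (u.2.1 i)‖ₑ ^ p) ^ (1 / p)

/-- The supremum norm of `x` on the set `s`. -/
def supNorm {E : Type*} [NormedAddCommGroup E] (x : ℝ → E) (s : Set ℝ) : ℝ≥0∞ :=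
  ⨆ t ∈ s, ‖x t‖ₑ

/-- The `p`-variation norm `‖x a‖ + |||x|||_{p-var,[a,b]}`. -/
def pVarNorm {E : Type*} [NormedAddCommGroup E] (p : ℝ) (x : ℝ → E) (a b : ℝ) : ℝ≥0∞ :=
  ‖x a‖ₑ + pVar p x (Icc a b)

/-- Continuous paths on `[0, ∞)` which have finite `p`-variation on `[0, T]` for every `T > 0`. -/
def LocFinPVar {E : Type*} [NormedAddCommGroup E] (p : ℝ) (x : ℝ → E) : Prop :=
  ContinuousOn x (Ici 0) ∧ ∀ T : ℝ, 0 < T → pVar p x (Icc 0 T) < ∞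

/-- For `a ≤ b`, the number `I` is the Young integral `∫_a^b x dω`: the limit of the sums
`∑ x (u i) (ω (u (i+1)) - ω (u i))` over the partitions `a = u 0 ≤ ⋯ ≤ u n = b` of `[a, b]`
as the mesh tends to zero. -/
def HasYoungIntegral {E : Type*} [NormedAddCommGroup E] [NormedSpace ℝ E]
    (x : ℝ → E) (ω : ℝ → ℝ) (a b : ℝ) (I : E) : Prop :=
  ∀ ε : ℝ, 0 < ε → ∃ δ : ℝ, 0 < δ ∧ ∀ (n : ℕ) (u : ℕ → ℝ), Monotone u → u 0 = a → u n = b →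
    (∀ i < n, u (i + 1) - u i < δ) →
    ‖(∑ i ∈ Finset.range n, (ω (u (i + 1)) - ω (u i)) • x (u i)) - I‖ < ε

/-- `x` is a solution on `[0, ∞)` of `dx = [A(t) x + F(t, x)] dt + C(t) x dω`: a continuous path
of locally finite `q`-variation that satisfies the integral equation, the drift being a Lebesgue
integral (which has to exist) and the last term a Young integral. -/
structure IsSolution {d : ℕ} (q : ℝ) (A : ℝ → Mat d) (F : ℝ → Vec d → Vec d) (C : ℝ → Mat d)
    (ω : ℝ → ℝ) (x : ℝ → Vec d) : Prop where
  finPVar : LocFinPVar q x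
  integrable : ∀ t : ℝ, 0 ≤ t →
    IntervalIntegrable (fun s => A s (x s) + F s (x s)) volume 0 t
  equation : ∀ t : ℝ, 0 ≤ t → HasYoungIntegral (fun s => C s (x s)) ω 0 t
    (x t - x 0 - ∫ s in (0 : ℝ)..t, (A s (x s) + F s (x s)))

/-- The solution `μ` is stable. -/
def IsStable {d : ℕ} (q : ℝ) (A : ℝ → Mat d) (F : ℝ → Vec d → Vec d) (C : ℝ → Mat d)
    (ω : ℝ → ℝ) (μ : ℝ → Vec d) : Prop :=
  IsSolution q A F C ω μ ∧
  ∀ ε : ℝ, 0 < ε → ∃ r : ℝ, 0 < r ∧ ∀ x : ℝ → Vec d, IsSolution q A F C ω x →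
    ‖x 0 - μ 0‖ < r → (⨆ t ∈ Ici (0 : ℝ), ‖x t - μ t‖ₑ) < ENNReal.ofReal ε

/-- The solution `μ` is exponentially stable: it is stable, and
`limsup (1/t) log ‖x t - μ t‖ < 0` for all solutions `x` that start close enough to `μ`.
The logarithm takes values in `[-∞, ∞]`, with `log 0 = -∞`. -/
def IsExpStable {d : ℕ} (q : ℝ) (A : ℝ → Mat d) (F : ℝ → Vec d → Vec d) (C : ℝ → Mat d)
    (ω : ℝ → ℝ) (μ : ℝ → Vec d) : Prop :=
  IsStable q A F C ω μ ∧
  ∃ r : ℝ, 0 < r ∧ ∀ x : ℝ → Vec d, IsSolution q A F C ω x → ‖x 0 - μ 0‖ < r →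
    limsup (fun t : ℝ => ((1 / t : ℝ) : EReal) * ENNReal.log ‖x t - μ t‖ₑ) atTop < 0

/-- `limsup_m ((1/(m+1)) ∑_{k=0}^m (a k) ^ r) ^ (1/r)`. -/
def limsupMean (r : ℝ) (a : ℕ → ℝ≥0∞) : ℝ≥0∞ :=
  limsup (fun m : ℕ => ((∑ k ∈ Finset.range (m + 1), a k ^ r) / ((m : ℝ≥0∞) + 1)) ^ (1 / r)) atTop

/-- The interval `Δ_k = [k, k+1]`. -/
def unitIvl (k : ℕ) : Set ℝ := Icc (k : ℝ) ((k : ℝ) + 1)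

/-- `Â`, the averaged sup norm of `A` and `f`. -/
def hatA {d : ℕ} (p : ℝ) (A : ℝ → Mat d) (f : ℝ → ℝ) : ℝ≥0∞ :=
  limsupMean (4 * p) fun k => supNorm A (unitIvl k) + supNorm f (unitIvl k)

/-- `Ĉ`, the averaged `q`-variation norm of `C`. -/
def hatC {d : ℕ} (p q : ℝ) (C : ℝ → Mat d) : ℝ≥0∞ :=
  limsupMean (2 * p + 2) fun k => pVarNorm q C (k : ℝ) ((k : ℝ) + 1)

/-- `Γ(ω, r)`, the averaged `p`-variation seminorm of `ω`. -/
def Gam (p : ℝ) (ω : ℝ → ℝ) (r : ℝ) : ℝ≥0∞ :=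
  limsupMean r fun k => pVar p ω (unitIvl k)

/-- The constant `K = (1 - 2^(1-θ))⁻¹`, `θ = 1/p + 1/q`, of the Young-Loeve estimate. -/
def youngK (p q : ℝ) : ℝ := (1 - (2 : ℝ) ^ (1 - (1 / p + 1 / q)))⁻¹

/-- `Ĝ = max {8 Â, 16 K Ĉ, 8^p Â^p, 16^p K^p Ĉ^p}`. -/
def hatG (p K : ℝ) (a c : ℝ≥0∞) : ℝ≥0∞ :=
  max (max (8 * a) (16 * ENNReal.ofReal K * c))
    (max (8 ^ p * a ^ p) (16 ^ p * ENNReal.ofReal K ^ p * c ^ p))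

end YoungStability

end

/-!
Along a solution that does not vanish, `log ‖x‖` and the direction `y = x / ‖x‖` satisfy Young
equations of their own. The drift contributes at most `∫ (f - h)` to `log ‖x‖`, and the noise the
Young integral of `⟪y, C y⟫`, which is bounded by the Young inequality in terms of the
`q`-variation of `y`. So three estimates have to be combined.

* The Young inequality with constant `(1 - 2^(1-θ))⁻¹` (`norm_youngSum_sub_le_youngK`). It is
  proved for finite Riemann sums, by removing partition points one at a time; the resulting
  constant `∑ k^(-θ)` is compared with the geometric series by condensation. No chain rule for
  Young integrals is needed: `exists_sum_norm_sub_le` and `IsYoungPath.exists_sum_sq_le` give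
  partitions along which the remainders and the squared increments have small sums, and the
  equations of `log ‖x‖` and `y` are replaced by second order expansions along them.
* A bound for the `q`-variation of `y` over a unit interval that is linear in
  `a = ‖A‖_∞ + ‖f‖_∞` and in `W = |||ω|||_p` (`IsYoungPath.varLE_direction`). On intervals where
  `M = a * length + 2 K c W` (with `c = ‖C‖_{q-var}`) is at most `1/4`, the Young inequality can
  be solved for the variation of `y`. Longer sequences are cut greedily into such blocks
  (`VarLE.of_local`); the number of blocks is controlled because `M^p` is superadditive, and the
  steps between blocks are harmless because `‖y‖ = 1`.
* Over `[k, k + 1]` this gives a growth of at most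
  `∫ (f - h) + K c W (1 + 32 a + 64 K c W)`, and Hölder's inequality bounds the mean of the
  second term by the stability criterion (`IsAdmissible.limsupMean_growthBound_le`).

The bound for `log ‖x‖` also shows that a solution which vanishes once vanishes from then on
(`IsAdmissible.ne_zero`), so every solution decays exponentially, with constants that do not
depend on it (`IsAdmissible.exists_norm_le_exp`).
-/

noncomputable section

namespace YoungStability

section

/-! ### Finite sums of powers -/

theorem sum_rpow_mul_rpow_le_of_add_eq_one {ι : Type*} (s : Finset ι) {a b : ι → ℝ} {α β : ℝ}
    (hα : 0 < α) (hβ : 0 < β) (h : α + β = 1)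
    (ha : ∀ i ∈ s, 0 ≤ a i) (hb : ∀ i ∈ s, 0 ≤ b i) :
    ∑ i ∈ s, a i ^ α * b i ^ β ≤ (∑ i ∈ s, a i) ^ α * (∑ i ∈ s, b i) ^ β := by
  have hc : (1 / α).HolderConjugate (1 / β) := by
    rw [Real.holderConjugate_iff]
    constructor
    · rw [lt_div_iff₀ hα]; linarith
    · simpa using h
  have := Real.inner_le_Lp_mul_Lq_of_nonneg s hc (f := fun i => a i ^ α) (g := fun i => b i ^ β)
    (fun i hi => Real.rpow_nonneg (ha i hi) _) (fun i hi => Real.rpow_nonneg (hb i hi) _)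
  refine this.trans (le_of_eq ?_)
  simp only [one_div_one_div]
  congr 2
  · exact Finset.sum_congr rfl fun i hi => by
      rw [← Real.rpow_mul (ha i hi), mul_one_div_cancel hα.ne', Real.rpow_one]
  · exact Finset.sum_congr rfl fun i hi => by
      rw [← Real.rpow_mul (hb i hi), mul_one_div_cancel hβ.ne', Real.rpow_one]

/-- Hölder's inequality for exponents with `α + β ≥ 1`: each term is at most the total, so the
excess of the exponents over `1` can be taken out of the sum. -/
theorem sum_rpow_mul_rpow_le {ι : Type*} (s : Finset ι) {a b : ι → ℝ} {α β : ℝ}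
    (hα : 0 < α) (hβ : 0 < β) (h : 1 ≤ α + β)
    (ha : ∀ i ∈ s, 0 ≤ a i) (hb : ∀ i ∈ s, 0 ≤ b i) :
    ∑ i ∈ s, a i ^ α * b i ^ β ≤ (∑ i ∈ s, a i) ^ α * (∑ i ∈ s, b i) ^ β := by
  set S := ∑ i ∈ s, a i with hS
  set T := ∑ i ∈ s, b i with hT
  have hS0 : 0 ≤ S := Finset.sum_nonneg ha
  have hT0 : 0 ≤ T := Finset.sum_nonneg hb
  set θ := α + β with hθ
  have hθ0 : 0 < θ := by linarith
  have key : ∀ {γ x X : ℝ}, 0 < γ → 0 ≤ x → x ≤ X →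
      x ^ γ ≤ x ^ (γ / θ) * X ^ (γ - γ / θ) := by
    intro γ x X hγ hx hX
    have h1 : γ / θ ≤ γ := div_le_self hγ.le h
    calc x ^ γ = x ^ (γ / θ + (γ - γ / θ)) := by ring_nf
      _ = x ^ (γ / θ) * x ^ (γ - γ / θ) :=
        Real.rpow_add_of_nonneg hx (by positivity) (by linarith)
      _ ≤ _ := by
        gcongr
  have key2 : ∀ {γ X : ℝ}, 0 < γ → 0 ≤ X → X ^ γ = X ^ (γ / θ) * X ^ (γ - γ / θ) := by
    intro γ X hγ hX
    have h1 : γ / θ ≤ γ := div_le_self hγ.le h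
    rw [← Real.rpow_add_of_nonneg hX (by positivity) (by linarith)]
    ring_nf
  calc ∑ i ∈ s, a i ^ α * b i ^ β
      ≤ ∑ i ∈ s, (a i ^ (α / θ) * b i ^ (β / θ)) * (S ^ (α - α / θ) * T ^ (β - β / θ)) := by
        refine Finset.sum_le_sum fun i hi => ?_
        have h1 := key hα (ha i hi) (Finset.single_le_sum ha hi)
        have h2 := key hβ (hb i hi) (Finset.single_le_sum hb hi)
        calc a i ^ α * b i ^ β ≤ _ := mul_le_mul h1 h2 (Real.rpow_nonneg (hb i hi) _)
              (mul_nonneg (Real.rpow_nonneg (ha i hi) _) (Real.rpow_nonneg hS0 _))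
          _ = _ := by ring
    _ = (∑ i ∈ s, a i ^ (α / θ) * b i ^ (β / θ)) * (S ^ (α - α / θ) * T ^ (β - β / θ)) := by
        rw [Finset.sum_mul]
    _ ≤ (S ^ (α / θ) * T ^ (β / θ)) * (S ^ (α - α / θ) * T ^ (β - β / θ)) := by
        gcongr
        exact sum_rpow_mul_rpow_le_of_add_eq_one s (by positivity) (by positivity)
          (by rw [← add_div, ← hθ, div_self hθ0.ne']) ha hb
    _ = S ^ α * T ^ β := by rw [key2 hα hS0, key2 hβ hT0]; ring

theorem sum_rpow_le_rpow_sum {ι : Type*} (s : Finset ι) {a : ι → ℝ} {r : ℝ} (hr : 1 ≤ r)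
    (ha : ∀ i ∈ s, 0 ≤ a i) : ∑ i ∈ s, a i ^ r ≤ (∑ i ∈ s, a i) ^ r := by
  have hS : 0 ≤ ∑ i ∈ s, a i := Finset.sum_nonneg ha
  have h : ∀ {x : ℝ}, 0 ≤ x → x ^ r = x * x ^ (r - 1) := by
    intro x hx
    rw [← Real.rpow_one_add' hx (by linarith)]
    ring_nf
  rw [h hS, Finset.sum_mul]
  refine Finset.sum_le_sum fun i hi => ?_
  rw [h (ha i hi)]
  have h1 := Finset.single_le_sum ha hi
  have h2 := ha i hi
  gcongr

/-- The `ℓ^q` norm is at most the `ℓ^p` norm if `p ≤ q`. -/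
theorem sum_rpow_le_rpow_of_le {ι : Type*} (s : Finset ι) {a : ι → ℝ} {p q V : ℝ} (hp : 0 < p)
    (hpq : p ≤ q) (hV : 0 ≤ V) (ha : ∀ i ∈ s, 0 ≤ a i) (h : ∑ i ∈ s, a i ^ p ≤ V ^ p) :
    ∑ i ∈ s, a i ^ q ≤ V ^ q := by
  have e : ∀ {x : ℝ}, 0 ≤ x → x ^ q = (x ^ p) ^ (q / p) := by
    intro x hx
    rw [← Real.rpow_mul hx, mul_div_cancel₀ _ hp.ne']
  have hn : ∀ i ∈ s, 0 ≤ a i ^ p := fun i hi => Real.rpow_nonneg (ha i hi) _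
  calc ∑ i ∈ s, a i ^ q = ∑ i ∈ s, (a i ^ p) ^ (q / p) :=
        Finset.sum_congr rfl fun i hi => e (ha i hi)
    _ ≤ (∑ i ∈ s, a i ^ p) ^ (q / p) := sum_rpow_le_rpow_sum s ((one_le_div hp).2 hpq) hn
    _ ≤ (V ^ p) ^ (q / p) := by
        have := Finset.sum_nonneg hn
        have : 0 ≤ q / p := by have : 0 < q := by linarith
                               positivity
        gcongr
    _ = V ^ q := (e hV).symm

/-- Minkowski's inequality, without roots. -/
theorem sum_add_rpow_le {ι : Type*} (s : Finset ι) {f g : ι → ℝ} {p V W : ℝ} (hp : 1 ≤ p)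
    (hV : 0 ≤ V) (hW : 0 ≤ W) (hf : ∀ i ∈ s, 0 ≤ f i) (hg : ∀ i ∈ s, 0 ≤ g i)
    (h1 : ∑ i ∈ s, f i ^ p ≤ V ^ p) (h2 : ∑ i ∈ s, g i ^ p ≤ W ^ p) :
    ∑ i ∈ s, (f i + g i) ^ p ≤ (V + W) ^ p := by
  have hp0 : 0 < p := by linarith
  have h := Real.Lp_add_le_of_nonneg s hp hf hg
  have root : ∀ {x X : ℝ}, 0 ≤ x → 0 ≤ X → x ≤ X ^ p → x ^ (1 / p) ≤ X := by
    intro x X hx hX hxX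
    rw [one_div]
    exact (Real.rpow_inv_le_iff_of_pos hx hX hp0).2 hxX
  have s1 := root (Finset.sum_nonneg fun i hi => Real.rpow_nonneg (hf i hi) _) hV h1
  have s2 := root (Finset.sum_nonneg fun i hi => Real.rpow_nonneg (hg i hi) _) hW h2
  have s3 := h.trans (add_le_add s1 s2)
  rw [one_div] at s3
  exact (Real.rpow_inv_le_iff_of_pos (Finset.sum_nonneg fun i hi =>
    Real.rpow_nonneg (add_nonneg (hf i hi) (hg i hi)) _) (by positivity) hp0).1 s3

/-- The partial sums of the zeta series at `θ > 1` are bounded by `(1 - 2^(1-θ))⁻¹`: Cauchy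
condensation turns the series into a geometric one. -/
theorem sum_Ico_rpow_neg_le {θ : ℝ} (hθ : 1 < θ) (n : ℕ) :
    ∑ k ∈ Finset.Ico 1 n, (k : ℝ) ^ (-θ) ≤ (1 - (2 : ℝ) ^ (1 - θ))⁻¹ := by
  have hx0 : (0 : ℝ) < 2 ^ (1 - θ) := by positivity
  have hx1 : (2 : ℝ) ^ (1 - θ) < 1 := Real.rpow_lt_one_of_one_lt_of_neg (by norm_num) (by linarith)
  have hc := Finset.le_sum_condensed (f := fun k : ℕ => (k : ℝ) ^ (-θ)) (by
    intro m k hm hmk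
    have : (0 : ℝ) < m := by exact_mod_cast hm
    exact Real.rpow_le_rpow_of_nonpos this (by exact_mod_cast hmk) (by linarith)) n
  have h0 : ((0 : ℕ) : ℝ) ^ (-θ) = 0 := by
    rw [Nat.cast_zero, Real.zero_rpow (by linarith)]
  simp only [h0, zero_add] at hc
  have hsub : ∑ k ∈ Finset.Ico 1 n, (k : ℝ) ^ (-θ) ≤
      ∑ k ∈ Finset.range (2 ^ n), (k : ℝ) ^ (-θ) := by
    refine Finset.sum_le_sum_of_subset_of_nonneg ?_ fun i _ _ => by positivity
    intro k hk
    rw [Finset.mem_Ico] at hk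
    exact Finset.mem_range.2 (hk.2.trans Nat.lt_two_pow_self)
  refine hsub.trans (hc.trans ?_)
  have he : ∀ k : ℕ, (2 ^ k : ℕ) • (((2 ^ k : ℕ) : ℝ) ^ (-θ)) = ((2 : ℝ) ^ (1 - θ)) ^ k := by
    intro k
    rw [nsmul_eq_mul]
    push_cast
    rw [← Real.rpow_natCast 2 k, ← Real.rpow_mul (by norm_num), ← Real.rpow_add (by norm_num),
      ← Real.rpow_natCast, ← Real.rpow_mul (by norm_num)]
    ring_nf
  simp only [he]
  have := (summable_geometric_of_lt_one hx0.le hx1).sum_le_tsum (Finset.range n)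
    (fun i _ => by positivity)
  rwa [tsum_geometric_of_lt_one hx0.le hx1] at this

theorem one_le_youngK {p q : ℝ} (hθ : 1 < 1 / p + 1 / q) : 1 ≤ youngK p q := by
  have h := sum_Ico_rpow_neg_le hθ 2
  simpa [youngK] using h

/-! ### Concatenation of finite sequences -/

/-- The finite sequence `u 0, …, u n, v 0, v 1, …`. -/
def concat (n : ℕ) (u v : ℕ → ℝ) (i : ℕ) : ℝ := if i ≤ n then u i else v (i - (n + 1))

theorem concat_of_le {n i : ℕ} (u v : ℕ → ℝ) (h : i ≤ n) : concat n u v i = u i := if_pos h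

theorem concat_add (n i : ℕ) (u v : ℕ → ℝ) : concat n u v (n + 1 + i) = v i := by
  rw [concat, if_neg (by omega), Nat.add_sub_cancel_left]

theorem monotone_concat {n : ℕ} {u v : ℕ → ℝ} (hu : Monotone u) (hv : Monotone v)
    (h : u n ≤ v 0) : Monotone (concat n u v) := by
  refine monotone_nat_of_le_succ fun i => ?_
  unfold concat
  split_ifs with h1 h2 h2
  · exact hu (Nat.le_succ i)
  · exact (hu h1).trans (h.trans (hv (Nat.zero_le _)))
  · omega
  · exact hv (by omega)

theorem sum_concat {M : Type*} [AddCommMonoid M] (G : ℝ → ℝ → M) (n m : ℕ) (u v : ℕ → ℝ) :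
    ∑ i ∈ Finset.range (n + 1 + m), G (concat n u v i) (concat n u v (i + 1)) =
      ∑ i ∈ Finset.range n, G (u i) (u (i + 1)) + G (u n) (v 0) +
        ∑ i ∈ Finset.range m, G (v i) (v (i + 1)) := by
  rw [Finset.sum_range_add, Finset.sum_range_succ]
  congr 1
  · congr 1
    · refine Finset.sum_congr rfl fun i hi => ?_
      rw [Finset.mem_range] at hi
      rw [concat_of_le u v (by omega), concat_of_le u v (by omega)]
    · have := concat_add n 0 u v
      rw [add_zero] at this
      rw [concat_of_le u v le_rfl, this]
  · refine Finset.sum_congr rfl fun i _ => ?_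
    rw [concat_add, add_assoc, concat_add]

end

section

variable {E G : Type*} [NormedAddCommGroup E] [NormedAddCommGroup G]

/-! ### Real bounds on the variation over an interval -/

/-- The `p`-variation seminorm of `x` on `[s, t]` is at most the real number `V`. Only the first
`n + 1` members of a sequence are required to lie in `[s, t]`. -/
def VarLE (p : ℝ) (x : ℝ → E) (s t V : ℝ) : Prop :=
  ∀ (n : ℕ) (u : ℕ → ℝ), Monotone u → s ≤ u 0 → u n ≤ t →
    ∑ i ∈ Finset.range n, ‖x (u (i + 1)) - x (u i)‖ ^ p ≤ V ^ p

/-- The `p`-variation seminorm of `x` on `[s, t]` as a real number; it is `0` if the seminorm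
is infinite. -/
def pVarReal (p : ℝ) (x : ℝ → E) (s t : ℝ) : ℝ := (pVar p x (Icc s t)).toReal

theorem pVarReal_nonneg (p : ℝ) (x : ℝ → E) (s t : ℝ) : 0 ≤ pVarReal p x s t :=
  ENNReal.toReal_nonneg

theorem sum_enorm_rpow (p : ℝ) (hp : 0 ≤ p) (n : ℕ) (z : ℕ → E) :
    ∑ i ∈ Finset.range n, ‖z i‖ₑ ^ p = ENNReal.ofReal (∑ i ∈ Finset.range n, ‖z i‖ ^ p) := by
  rw [ENNReal.ofReal_sum_of_nonneg fun i _ => by positivity]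
  refine Finset.sum_congr rfl fun i _ => ?_
  rw [← ENNReal.ofReal_rpow_of_nonneg (norm_nonneg _) hp, ofReal_norm]

theorem pVar_le_ofReal_iff {p : ℝ} (hp : 0 < p) {x : ℝ → E} {s t V : ℝ} (hV : 0 ≤ V) :
    pVar p x (Icc s t) ≤ ENNReal.ofReal V ↔ VarLE p x s t V := by
  rw [pVar, one_div, ENNReal.rpow_inv_le_iff hp, iSup_le_iff,
    ENNReal.ofReal_rpow_of_nonneg hV hp.le]
  constructor
  · intro h n u hu h0 hn
    -- freeze the sequence after its `n`-th member
    have h' := h ⟨n, fun i => u (min i n), fun i j hij => hu (min_le_min_right _ hij), fun i =>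
      ⟨h0.trans (hu (Nat.zero_le _)), (hu (min_le_right _ _)).trans hn⟩⟩
    dsimp only at h'
    rw [sum_enorm_rpow p hp.le n (fun i => x (u (min (i + 1) n)) - x (u (min i n))),
      ENNReal.ofReal_le_ofReal_iff (by positivity)] at h'
    refine le_of_eq_of_le (Finset.sum_congr rfl fun i hi => ?_) h'
    rw [Finset.mem_range] at hi
    rw [min_eq_left hi.le, min_eq_left hi]
  · rintro h ⟨n, u, hu, hmem⟩
    dsimp only
    rw [sum_enorm_rpow p hp.le n (fun i => x (u (i + 1)) - x (u i))]
    exact ENNReal.ofReal_le_ofReal (h n u hu (hmem 0).1 (hmem n).2)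

theorem varLE_pVarReal {p : ℝ} (hp : 0 < p) {x : ℝ → E} {s t : ℝ}
    (h : pVar p x (Icc s t) < ∞) : VarLE p x s t (pVarReal p x s t) := by
  rw [← pVar_le_ofReal_iff hp (pVarReal_nonneg _ _ _ _), pVarReal, ENNReal.ofReal_toReal h.ne]

theorem VarLE.pVarReal_le {p : ℝ} (hp : 0 < p) {x : ℝ → E} {s t V : ℝ} (hV : 0 ≤ V)
    (h : VarLE p x s t V) : pVarReal p x s t ≤ V :=
  ENNReal.toReal_le_of_le_ofReal hV ((pVar_le_ofReal_iff hp hV).2 h)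

theorem VarLE.varLE_pVarReal {p : ℝ} (hp : 0 < p) {x : ℝ → E} {s t V : ℝ} (hV : 0 ≤ V)
    (h : VarLE p x s t V) : VarLE p x s t (pVarReal p x s t) :=
  YoungStability.varLE_pVarReal hp
    (lt_of_le_of_lt ((pVar_le_ofReal_iff hp hV).2 h) ENNReal.ofReal_lt_top)

theorem VarLE.mono {p : ℝ} (hp : 0 < p) {x : ℝ → E} {s t s' t' V V' : ℝ} (h : VarLE p x s t V)
    (hV : 0 ≤ V) (hVV : V ≤ V') (hs : s ≤ s') (ht : t' ≤ t) : VarLE p x s' t' V' :=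
  fun n u hu h0 hn => (h n u hu (hs.trans h0) (hn.trans ht)).trans (by gcongr)

theorem VarLE.norm_sub_le {p : ℝ} (hp : 0 < p) {x : ℝ → E} {s t V : ℝ} (h : VarLE p x s t V)
    (hV : 0 ≤ V) {a b : ℝ} (ha : s ≤ a) (hab : a ≤ b) (hb : b ≤ t) : ‖x b - x a‖ ≤ V := by
  have := h 1 (fun i => if i = 0 then a else b) (by
    refine monotone_nat_of_le_succ fun i => ?_
    by_cases hi : i = 0 <;> simp [hi, hab]) (by simpa) (by simpa)
  simp only [Finset.range_one, Finset.sum_singleton, zero_add, one_ne_zero, if_true,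
    if_false] at this
  exact (Real.rpow_le_rpow_iff (norm_nonneg _) hV hp).1 this

/-- A path whose increments are dominated by those of two others. -/
theorem VarLE.of_norm_sub_le {E' G' : Type*} [NormedAddCommGroup E'] [NormedAddCommGroup G']
    {p : ℝ} (hp : 1 ≤ p) {x : ℝ → E'} {y : ℝ → G'} {z : ℝ → E}
    {s t V W α β : ℝ} (hx : VarLE p x s t V) (hy : VarLE p y s t W) (hV : 0 ≤ V) (hW : 0 ≤ W)
    (hα : 0 ≤ α) (hβ : 0 ≤ β)
    (h : ∀ a b, s ≤ a → a ≤ b → b ≤ t → ‖z b - z a‖ ≤ α * ‖x b - x a‖ + β * ‖y b - y a‖) :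
    VarLE p z s t (α * V + β * W) := by
  intro n u hu h0 hn
  have hp0 : 0 < p := by linarith
  have hs : ∀ {γ X : ℝ} {a : ℕ → ℝ}, 0 ≤ γ → 0 ≤ X → (∀ i, 0 ≤ a i) →
      ∑ i ∈ Finset.range n, a i ^ p ≤ X ^ p →
      ∑ i ∈ Finset.range n, (γ * a i) ^ p ≤ (γ * X) ^ p := by
    intro γ X a hγ hX ha hle
    rw [Real.mul_rpow hγ hX]
    calc _ = γ ^ p * ∑ i ∈ Finset.range n, a i ^ p := by
          rw [Finset.mul_sum]
          exact Finset.sum_congr rfl fun i _ => Real.mul_rpow hγ (ha i)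
      _ ≤ _ := by gcongr
  refine le_trans (Finset.sum_le_sum fun i hi => ?_)
    (sum_add_rpow_le (Finset.range n) hp (mul_nonneg hα hV) (mul_nonneg hβ hW)
      (fun i _ => mul_nonneg hα (norm_nonneg _)) (fun i _ => mul_nonneg hβ (norm_nonneg _))
      (hs hα hV (fun i => norm_nonneg _) (hx n u hu h0 hn))
      (hs hβ hW (fun i => norm_nonneg _) (hy n u hu h0 hn)))
  rw [Finset.mem_range] at hi
  exact Real.rpow_le_rpow (norm_nonneg _) (h _ _ (h0.trans (hu (Nat.zero_le _)))
    (hu (Nat.le_succ i)) ((hu hi).trans hn)) hp0.le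

theorem VarLE.of_norm_sub_le_mul {E' : Type*} [NormedAddCommGroup E']
    {p : ℝ} (hp : 1 ≤ p) {x : ℝ → E'} {z : ℝ → E}
    {s t V α : ℝ} (hx : VarLE p x s t V) (hV : 0 ≤ V) (hα : 0 ≤ α)
    (h : ∀ a b, s ≤ a → a ≤ b → b ≤ t → ‖z b - z a‖ ≤ α * ‖x b - x a‖) :
    VarLE p z s t (α * V) := by
  have := VarLE.of_norm_sub_le hp hx hx hV hV hα le_rfl (z := z) (by simpa using h)
  simpa using this

/-- Concatenating sequences in `[s, r]` and in `[r, t]` shows that the `p`-th power of the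
`p`-variation is superadditive. -/
theorem VarLE.pVarReal_rpow_add_le {p : ℝ} (hp : 0 < p) {x : ℝ → E} {s r t V : ℝ}
    (h : VarLE p x s t V) (hsr : s ≤ r) (hrt : r ≤ t) :
    pVarReal p x s r ^ p + pVarReal p x r t ^ p ≤ V ^ p := by
  have root : ∀ {X Y : ℝ}, 0 ≤ X → 0 ≤ Y → (X ≤ Y ^ (1 / p) → X ^ p ≤ Y) := by
    intro X Y hX hY hXY
    rw [one_div] at hXY
    exact (Real.le_rpow_inv_iff_of_pos hX hY hp).1 hXY
  have pow : ∀ {Y : ℝ}, 0 ≤ Y → (Y ^ (1 / p)) ^ p = Y := by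
    intro Y hY
    rw [← Real.rpow_mul hY, one_div_mul_cancel hp.ne', Real.rpow_one]
  -- both suprema are taken by bounding one sum with the other one fixed
  have two : ∀ (n : ℕ) (u : ℕ → ℝ), Monotone u → s ≤ u 0 → u n ≤ r →
      ∀ (m : ℕ) (v : ℕ → ℝ), Monotone v → r ≤ v 0 → v m ≤ t →
      ∑ i ∈ Finset.range n, ‖x (u (i + 1)) - x (u i)‖ ^ p +
        ∑ i ∈ Finset.range m, ‖x (v (i + 1)) - x (v i)‖ ^ p ≤ V ^ p := by
    intro n u hu hu0 hun m v hv hv0 hvm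
    have := h (n + 1 + m) (concat n u v) (monotone_concat hu hv (hun.trans hv0))
      (by rw [concat_of_le u v (Nat.zero_le n)]; exact hu0) (by rw [concat_add]; exact hvm)
    rw [sum_concat (fun a b => ‖x b - x a‖ ^ p)] at this
    have h0 : 0 ≤ ‖x (v 0) - x (u n)‖ ^ p := by positivity
    linarith
  have one : ∀ (m : ℕ) (v : ℕ → ℝ), Monotone v → r ≤ v 0 → v m ≤ t →
      ∑ i ∈ Finset.range m, ‖x (v (i + 1)) - x (v i)‖ ^ p ≤ V ^ p - pVarReal p x s r ^ p := by
    intro m v hv hv0 hvm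
    set X := V ^ p - ∑ i ∈ Finset.range m, ‖x (v (i + 1)) - x (v i)‖ ^ p with hX
    have hX0 : 0 ≤ X := by
      have := two 0 (fun _ => r) monotone_const hsr le_rfl m v hv hv0 hvm
      simp only [Finset.range_zero, Finset.sum_empty, zero_add] at this
      linarith
    have : VarLE p x s r (X ^ (1 / p)) := by
      intro n u hu hu0 hun
      rw [pow hX0]
      have := two n u hu hu0 hun m v hv hv0 hvm
      linarith
    have := root (pVarReal_nonneg _ _ _ _) hX0 (this.pVarReal_le hp (by positivity))
    linarith
  have hX0 : 0 ≤ V ^ p - pVarReal p x s r ^ p := by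
    simpa using one 0 (fun _ => r) monotone_const le_rfl hrt
  have : VarLE p x r t ((V ^ p - pVarReal p x s r ^ p) ^ (1 / p)) := by
    intro m v hv hv0 hvm
    rw [pow hX0]
    exact one m v hv hv0 hvm
  have := root (pVarReal_nonneg _ _ _ _) hX0 (this.pVarReal_le hp (by positivity))
  linarith

theorem VarLE.sum_pVarReal_rpow_le {p : ℝ} (hp : 0 < p) {x : ℝ → E} {s t V : ℝ}
    (h : VarLE p x s t V) (hV : 0 ≤ V) {n : ℕ} {u : ℕ → ℝ} (hu : Monotone u) (h0 : s ≤ u 0)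
    (hn : u n ≤ t) : ∑ i ∈ Finset.range n, pVarReal p x (u i) (u (i + 1)) ^ p ≤ V ^ p := by
  suffices H : ∀ k ≤ n, ∑ i ∈ Finset.range k, pVarReal p x (u i) (u (i + 1)) ^ p ≤
      pVarReal p x (u 0) (u k) ^ p from
    (H n le_rfl).trans (Real.rpow_le_rpow (pVarReal_nonneg _ _ _ _)
      ((h.mono hp hV le_rfl h0 hn).pVarReal_le hp hV) hp.le)
  intro k
  induction k with
  | zero => intro _; simpa using Real.rpow_nonneg (pVarReal_nonneg _ _ _ _) _
  | succ k ih =>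
    intro hk
    rw [Finset.sum_range_succ]
    have hv := (h.mono hp hV le_rfl h0 ((hu hk).trans hn)).varLE_pVarReal hp hV
    have := hv.pVarReal_rpow_add_le hp (hu (Nat.zero_le k))
      (hu (Nat.le_succ k))
    have := ih (by omega)
    linarith

/-- The sums that bound the variation of a path with increments at most `α (b - a) + β W(a, b)`,
`W` being the `p`-variation of another path. -/
theorem VarLE.sum_linear_add_rpow_le {p : ℝ} (hp : 1 ≤ p) {x : ℝ → E} {s t V α β : ℝ}
    (h : VarLE p x s t V) (hV : 0 ≤ V) (hα : 0 ≤ α) (hβ : 0 ≤ β) {n : ℕ} {u : ℕ → ℝ}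
    (hu : Monotone u) (h0 : s ≤ u 0) (hn : u n ≤ t) :
    ∑ i ∈ Finset.range n,
      (α * (u (i + 1) - u i) + β * pVarReal p x (u i) (u (i + 1))) ^ p ≤
        (α * (t - s) + β * V) ^ p := by
  have hp0 : 0 < p := by linarith
  have hst : s ≤ t := h0.trans ((hu (Nat.zero_le n)).trans hn)
  have hd : ∀ i, 0 ≤ u (i + 1) - u i := fun i => sub_nonneg.2 (hu (Nat.le_succ i))
  refine sum_add_rpow_le (Finset.range n) hp (mul_nonneg hα (sub_nonneg.2 hst))
    (mul_nonneg hβ hV) (fun i _ => mul_nonneg hα (hd i))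
    (fun i _ => mul_nonneg hβ (pVarReal_nonneg _ _ _ _)) ?_ ?_
  · refine (sum_rpow_le_rpow_sum _ hp fun i _ => mul_nonneg hα (hd i)).trans ?_
    rw [← Finset.mul_sum, Finset.sum_range_sub]
    have : 0 ≤ u n - u 0 := sub_nonneg.2 (hu (Nat.zero_le n))
    gcongr
  · rw [Real.mul_rpow hβ hV]
    calc _ = β ^ p * ∑ i ∈ Finset.range n, pVarReal p x (u i) (u (i + 1)) ^ p := by
          rw [Finset.mul_sum]
          exact Finset.sum_congr rfl fun i _ => Real.mul_rpow hβ (pVarReal_nonneg _ _ _ _)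
      _ ≤ _ := by
          have := h.sum_pVarReal_rpow_le hp0 hV hu h0 hn
          gcongr

/-! ### The Young inequality for Riemann sums -/

variable [NormedSpace ℝ E]

/-- The left-point Riemann sum of `∫ z dω` along `u 0, …, u n`. -/
def youngSum (z : ℝ → E) (ω : ℝ → ℝ) (n : ℕ) (u : ℕ → ℝ) : E :=
  ∑ i ∈ Finset.range n, (ω (u (i + 1)) - ω (u i)) • z (u i)

/-- Young's argument: by Hölder, some interior point of the partition can be removed at the cost
of at most `(n - 1)^(-θ) Q W`, and removing all of them one after the other leaves the
one-step sum. -/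
theorem norm_youngSum_sub_le {p q : ℝ} (hp : 0 < p) (hq : 0 < q) {ω : ℝ → ℝ} {z : ℝ → E}
    {s t W Q : ℝ} (hW0 : 0 ≤ W) (hQ0 : 0 ≤ Q) (hW : VarLE p ω s t W) (hQ : VarLE q z s t Q)
    (n : ℕ) : ∀ u : ℕ → ℝ, Monotone u → s ≤ u 0 → u n ≤ t →
    ‖youngSum z ω n u - (ω (u n) - ω (u 0)) • z (u 0)‖ ≤
      (∑ k ∈ Finset.Ico 1 n, (k : ℝ) ^ (-(1 / p + 1 / q))) * (Q * W) := by
  set θ := 1 / p + 1 / q with hθ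
  have hθ0 : 0 < θ := by positivity
  induction n with
  | zero => intro u _ _ _; simp [youngSum]
  | succ n ih =>
    intro u hu h0 hn
    rcases Nat.eq_zero_or_pos n with rfl | hnpos
    · simp [youngSum]
    have hn' : (0 : ℝ) < n := by exact_mod_cast hnpos
    -- the product of neighbouring increments is small at some interior point
    obtain ⟨j, hj, hjle⟩ : ∃ j < n, ‖z (u (j + 1)) - z (u j)‖ *
        ‖ω (u (j + 2)) - ω (u (j + 1))‖ ≤ (n : ℝ) ^ (-θ) * (Q * W) := by
      by_contra! hcon
      have hc0 : 0 ≤ (n : ℝ) ^ (-θ) * (Q * W) := by positivity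
      have hh := sum_rpow_mul_rpow_le_of_add_eq_one (Finset.range n)
        (a := fun j => ‖z (u (j + 1)) - z (u j)‖ ^ q)
        (b := fun j => ‖ω (u (j + 2)) - ω (u (j + 1))‖ ^ p)
        (α := 1 / q / θ) (β := 1 / p / θ) (by positivity) (by positivity)
        (by rw [← add_div, add_comm, ← hθ, div_self hθ0.ne'])
        (fun _ _ => by positivity) (fun _ _ => by positivity)
      have hz := hQ n u hu h0 ((hu (Nat.le_succ n)).trans hn)
      have ho := hW n (fun i => u (i + 1)) (fun i k hik => hu (by omega))
        (h0.trans (hu (Nat.zero_le _))) hn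
      have hpow : ∀ {x r : ℝ}, 0 ≤ x → 0 < r → (x ^ r) ^ (1 / r / θ) = x ^ (1 / θ) := by
        intro x r hx hr
        rw [← Real.rpow_mul hx]
        congr 1
        field_simp
      have hup : (∑ j ∈ Finset.range n, ‖z (u (j + 1)) - z (u j)‖ ^ q) ^ (1 / q / θ) *
          (∑ j ∈ Finset.range n, ‖ω (u (j + 2)) - ω (u (j + 1))‖ ^ p) ^ (1 / p / θ) ≤
          (Q * W) ^ (1 / θ) := by
        rw [Real.mul_rpow hQ0 hW0, ← hpow hQ0 hq, ← hpow hW0 hp]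
        gcongr
      have hlow : ∑ j ∈ Finset.range n, ((n : ℝ) ^ (-θ) * (Q * W)) ^ (1 / θ) <
          ∑ j ∈ Finset.range n, (‖z (u (j + 1)) - z (u j)‖ ^ q) ^ (1 / q / θ) *
            (‖ω (u (j + 2)) - ω (u (j + 1))‖ ^ p) ^ (1 / p / θ) := by
        refine Finset.sum_lt_sum_of_nonempty (by simpa using hnpos.ne') fun j hj => ?_
        rw [hpow (norm_nonneg _) hq, hpow (norm_nonneg _) hp,
          ← Real.mul_rpow (norm_nonneg _) (norm_nonneg _)]
        exact Real.rpow_lt_rpow hc0 (hcon j (Finset.mem_range.1 hj)) (by positivity)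
      have hsum : ∑ j ∈ Finset.range n, ((n : ℝ) ^ (-θ) * (Q * W)) ^ (1 / θ) =
          (Q * W) ^ (1 / θ) := by
        rw [Finset.sum_const, Finset.card_range, nsmul_eq_mul,
          Real.mul_rpow (by positivity) (by positivity), ← Real.rpow_mul hn'.le,
          show -θ * (1 / θ) = -1 by field_simp, Real.rpow_neg_one, ← mul_assoc,
          mul_inv_cancel₀ hn'.ne', one_mul]
      linarith
    -- remove it
    set v : ℕ → ℝ := fun i => if i ≤ j then u i else u (i + 1) with hv
    have hvmono : Monotone v := by
      refine monotone_nat_of_le_succ fun i => ?_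
      simp only [hv]
      split_ifs with h1 h2 h2 <;> first | omega | exact hu (by omega)
    have hv0 : v 0 = u 0 := by simp [hv]
    have hvn : v n = u (n + 1) := by simp [hv, hj]
    have hdiff : youngSum z ω (n + 1) u - youngSum z ω n v =
        (ω (u (j + 2)) - ω (u (j + 1))) • (z (u (j + 1)) - z (u j)) := by
      obtain ⟨m, rfl⟩ : ∃ m, n = j + 1 + m := ⟨n - (j + 1), by omega⟩
      unfold youngSum
      rw [show j + 1 + m + 1 = (j + 1 + 1) + m by ring, Finset.sum_range_add _ (j + 1 + 1) m,
        Finset.sum_range_succ, Finset.sum_range_succ, Finset.sum_range_add _ (j + 1) m,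
        Finset.sum_range_succ]
      have e1 : ∑ i ∈ Finset.range j, (ω (v (i + 1)) - ω (v i)) • z (v i) =
          ∑ i ∈ Finset.range j, (ω (u (i + 1)) - ω (u i)) • z (u i) := by
        refine Finset.sum_congr rfl fun i hi => ?_
        rw [Finset.mem_range] at hi
        simp [hv, hi.le, Nat.succ_le_of_lt hi]
      have e2 : ∑ i ∈ Finset.range m, (ω (v (j + 1 + i + 1)) - ω (v (j + 1 + i))) •
          z (v (j + 1 + i)) = ∑ i ∈ Finset.range m,
            (ω (u (j + 1 + 1 + i + 1)) - ω (u (j + 1 + 1 + i))) • z (u (j + 1 + 1 + i)) := by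
        refine Finset.sum_congr rfl fun i _ => ?_
        have a1 : v (j + 1 + i + 1) = u (j + 1 + 1 + i + 1) := by
          simp only [hv]; rw [if_neg (by omega)]; congr 1; ring
        have a2 : v (j + 1 + i) = u (j + 1 + 1 + i) := by
          simp only [hv]; rw [if_neg (by omega)]; congr 1; ring
        rw [a1, a2]
      have a3 : v (j + 1) = u (j + 1 + 1) := by simp [hv]
      have a4 : v j = u j := by simp [hv]
      rw [e1, e2, a3, a4]
      module
    have hih := ih v hvmono (by rw [hv0]; exact h0) (by rw [hvn]; exact hn)
    rw [hv0, hvn] at hih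
    rw [Finset.sum_Ico_succ_top hnpos, add_mul]
    calc ‖youngSum z ω (n + 1) u - (ω (u (n + 1)) - ω (u 0)) • z (u 0)‖
        = ‖(youngSum z ω n v - (ω (u (n + 1)) - ω (u 0)) • z (u 0)) +
            (youngSum z ω (n + 1) u - youngSum z ω n v)‖ := by congr 1; abel
      _ ≤ _ := by
        refine (norm_add_le _ _).trans (add_le_add hih ?_)
        rw [hdiff, norm_smul, mul_comm]
        exact hjle

theorem norm_youngSum_sub_le_youngK {p q : ℝ} (hp : 0 < p) (hq : 0 < q) (hθ : 1 < 1 / p + 1 / q)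
    {ω : ℝ → ℝ} {z : ℝ → E}
    {s t W Q : ℝ} (hW0 : 0 ≤ W) (hQ0 : 0 ≤ Q) (hW : VarLE p ω s t W) (hQ : VarLE q z s t Q)
    {n : ℕ} {u : ℕ → ℝ} (hu : Monotone u) (h0 : s ≤ u 0) (hn : u n ≤ t) :
    ‖youngSum z ω n u - (ω (u n) - ω (u 0)) • z (u 0)‖ ≤ youngK p q * (Q * W) :=
  (norm_youngSum_sub_le hp hq hW0 hQ0 hW hQ n u hu h0 hn).trans
    (mul_le_mul_of_nonneg_right (sum_Ico_rpow_neg_le hθ n) (mul_nonneg hQ0 hW0))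

end

section

variable {E : Type*} [NormedAddCommGroup E] [NormedSpace ℝ E]

/-! ### Young integrals over subintervals -/

theorem exists_fine_partition {a b δ : ℝ} (hab : a ≤ b) (hδ : 0 < δ) :
    ∃ (n : ℕ) (u : ℕ → ℝ), Monotone u ∧ u 0 = a ∧ u n = b ∧ ∀ i, u (i + 1) - u i < δ := by
  obtain ⟨n, hn⟩ := exists_nat_gt ((b - a) / δ)
  have hn0 : (0 : ℝ) < n := lt_of_le_of_lt (div_nonneg (sub_nonneg.2 hab) hδ.le) hn
  have h0 : 0 ≤ (b - a) / n := div_nonneg (sub_nonneg.2 hab) hn0.le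
  refine ⟨n, fun i => a + i * ((b - a) / n), monotone_nat_of_le_succ fun i => ?_, by simp, ?_,
    fun i => ?_⟩
  · push_cast; nlinarith
  · field_simp; ring
  · push_cast
    have : (b - a) / n < δ := by rw [div_lt_iff₀ hn0]; rwa [div_lt_iff₀ hδ, mul_comm] at hn
    linarith

theorem HasYoungIntegral.sub {z : ℝ → E} {ω : ℝ → ℝ} {c a b : ℝ} {I J : E}
    (hI : HasYoungIntegral z ω c a I) (hJ : HasYoungIntegral z ω c b J) (hca : c ≤ a) :
    HasYoungIntegral z ω a b (J - I) := by
  intro ε hε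
  obtain ⟨δ₁, hδ₁, h1⟩ := hI (ε / 2) (by positivity)
  obtain ⟨δ₂, hδ₂, h2⟩ := hJ (ε / 2) (by positivity)
  refine ⟨min δ₁ δ₂, by positivity, fun n u hu h0 hn hfine => ?_⟩
  obtain ⟨m, w, hw, hw0, hwm, hwfine⟩ := exists_fine_partition hca (lt_min hδ₁ hδ₂)
  have e1 := h1 m w hw hw0 hwm fun i _ => (hwfine i).trans_le (min_le_left _ _)
  have e2 := h2 (m + 1 + n) (concat m w u) (monotone_concat hw hu (by rw [hwm, h0]))
    (by rw [concat_of_le w u (Nat.zero_le m), hw0]) (by rw [concat_add, hn]) (by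
      intro i hi
      rcases lt_trichotomy i m with h | rfl | h
      · rw [concat_of_le w u h, concat_of_le w u h.le]
        exact (hwfine i).trans_le (min_le_right _ _)
      · have := concat_add i 0 w u
        rw [add_zero] at this
        rw [this, concat_of_le w u le_rfl, hwm, h0, sub_self]
        exact hδ₂
      · obtain ⟨j, rfl⟩ : ∃ j, i = m + 1 + j := ⟨i - (m + 1), by omega⟩
        rw [add_assoc, concat_add, concat_add]
        exact (hfine j (by omega)).trans_le (min_le_right _ _))
  rw [sum_concat (fun a b => (ω b - ω a) • z a), hwm, h0, sub_self, zero_smul, add_zero] at e2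
  set S := ∑ i ∈ Finset.range m, (ω (w (i + 1)) - ω (w i)) • z (w i)
  set T := ∑ i ∈ Finset.range n, (ω (u (i + 1)) - ω (u i)) • z (u i)
  calc ‖T - (J - I)‖ = ‖(S + T - J) - (S - I)‖ := by congr 1; abel
    _ ≤ ‖S + T - J‖ + ‖S - I‖ := norm_sub_le _ _
    _ < ε := by linarith

theorem HasYoungIntegral.norm_sub_le {p q : ℝ} (hp : 0 < p) (hq : 0 < q)
    (hθ : 1 < 1 / p + 1 / q) {z : ℝ → E} {ω : ℝ → ℝ} {a b W Q : ℝ} {I : E}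
    (hI : HasYoungIntegral z ω a b I) (hab : a ≤ b) (hW0 : 0 ≤ W) (hQ0 : 0 ≤ Q)
    (hW : VarLE p ω a b W) (hQ : VarLE q z a b Q) :
    ‖I - (ω b - ω a) • z a‖ ≤ youngK p q * (Q * W) := by
  refine le_of_forall_pos_le_add fun ε hε => ?_
  obtain ⟨δ, hδ, h⟩ := hI ε hε
  obtain ⟨n, u, hu, hu0, hun, hfine⟩ := exists_fine_partition hab hδ
  have h1 := h n u hu hu0 hun fun i _ => hfine i
  have h2 := norm_youngSum_sub_le_youngK hp hq hθ hW0 hQ0 hW hQ hu hu0.ge hun.le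
  rw [hu0, hun] at h2
  calc ‖I - (ω b - ω a) • z a‖ = ‖(youngSum z ω n u - (ω b - ω a) • z a) -
        (youngSum z ω n u - I)‖ := by congr 1; abel
    _ ≤ _ := _root_.norm_sub_le _ _
    _ ≤ _ := add_le_add h2 h1.le

/-- Interpolation: a path with small increments has small `p'`-variation for every `p' > p`. -/
theorem VarLE.of_norm_sub_le_const {G : Type*} [NormedAddCommGroup G] {p p' : ℝ} (hp : 0 < p)
    (hpp : p ≤ p') {x : ℝ → G}
    {s t V o : ℝ} (h : VarLE p x s t V) (hV : 0 ≤ V) (ho : 0 ≤ o)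
    (hx : ∀ a b, s ≤ a → a ≤ b → b ≤ t → ‖x b - x a‖ ≤ o) :
    VarLE p' x s t ((V ^ p) ^ (1 / p') * o ^ (1 - p / p')) := by
  intro n u hu h0 hn
  have hp' : 0 < p' := by linarith
  have e : ((V ^ p) ^ (1 / p') * o ^ (1 - p / p')) ^ p' = V ^ p * o ^ (p' - p) := by
    rw [Real.mul_rpow (by positivity) (by positivity), ← Real.rpow_mul (by positivity),
      one_div_mul_cancel hp'.ne', Real.rpow_one, ← Real.rpow_mul ho]
    congr 2
    field_simp
  rw [e]
  calc _ ≤ ∑ i ∈ Finset.range n, ‖x (u (i + 1)) - x (u i)‖ ^ p * o ^ (p' - p) := by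
        refine Finset.sum_le_sum fun i hi => ?_
        rw [Finset.mem_range] at hi
        have hle := hx _ _ (h0.trans (hu (Nat.zero_le i))) (hu (Nat.le_succ i)) ((hu hi).trans hn)
        calc _ = ‖x (u (i + 1)) - x (u i)‖ ^ p * ‖x (u (i + 1)) - x (u i)‖ ^ (p' - p) := by
              rw [← Real.rpow_add_of_nonneg (norm_nonneg _) hp.le (by linarith)]
              congr 1
              ring
          _ ≤ _ := by
              have : 0 ≤ p' - p := by linarith
              gcongr
    _ = (∑ i ∈ Finset.range n, ‖x (u (i + 1)) - x (u i)‖ ^ p) * o ^ (p' - p) := by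
        rw [Finset.sum_mul]
    _ ≤ _ := by
        have := h n u hu h0 hn
        gcongr

theorem exists_le_of_continuousOn_Icc {G : Type*} [NormedAddCommGroup G] {x : ℝ → G} {s t : ℝ}
    (hx : ContinuousOn x (Icc s t)) {ε : ℝ} (hε : 0 < ε) :
    ∃ δ > 0, ∀ a b, s ≤ a → a ≤ b → b ≤ t → b - a < δ → ‖x b - x a‖ ≤ ε := by
  have := isCompact_Icc.uniformContinuousOn_of_continuous hx
  rw [Metric.uniformContinuousOn_iff] at this
  obtain ⟨δ, hδ, h⟩ := this ε hε
  refine ⟨δ, hδ, fun a b ha hab hb hlt => ?_⟩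
  have := h b ⟨ha.trans hab, hb⟩ a ⟨ha, hab.trans hb⟩ (by
    rw [Real.dist_eq, abs_of_nonneg (by linarith)]; exact hlt)
  rw [dist_eq_norm] at this
  exact this.le

theorem exists_rpow_mul_le {c γ ε : ℝ} (hγ : 0 < γ) (hε : 0 < ε) :
    ∃ o > 0, c * o ^ γ ≤ ε := by
  have : Tendsto (fun o : ℝ => c * o ^ γ) (nhdsWithin 0 (Ioi 0)) (nhds (c * 0 ^ γ)) :=
    ((Real.continuousAt_rpow_const 0 γ (Or.inr hγ.le)).tendsto.mono_left
      nhdsWithin_le_nhds).const_mul c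
  rw [Real.zero_rpow hγ.ne', mul_zero] at this
  obtain ⟨o, ho, hpos⟩ := ((this.eventually (eventually_lt_nhds hε)).and
    self_mem_nhdsWithin).exists
  exact ⟨o, hpos, ho.le⟩

/-- The local errors of the left-point approximation of a Young integral add up to a quantity
that vanishes with the mesh. The exponent `p` is increased slightly, so that the increments of
`ω` contribute a small factor. -/
theorem exists_sum_norm_sub_le {p q : ℝ} (hp : 0 < p) (hq : 1 < q)
    (hθ : 1 < 1 / p + 1 / q) {z J : ℝ → E} {ω : ℝ → ℝ} {s t W Q : ℝ} (hW0 : 0 ≤ W) (hQ0 : 0 ≤ Q)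
    (hω : ContinuousOn ω (Icc s t)) (hW : VarLE p ω s t W) (hQ : VarLE q z s t Q)
    (hJ : ∀ a b, s ≤ a → a ≤ b → b ≤ t → HasYoungIntegral z ω a b (J b - J a))
    {ε : ℝ} (hε : 0 < ε) :
    ∃ δ > 0, ∀ (n : ℕ) (u : ℕ → ℝ), Monotone u → s ≤ u 0 → u n ≤ t →
      (∀ i < n, u (i + 1) - u i < δ) →
      ∑ i ∈ Finset.range n,
        ‖J (u (i + 1)) - J (u i) - (ω (u (i + 1)) - ω (u i)) • z (u i)‖ ≤ ε := by
  have hq0 : 0 < q := by linarith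
  have hq1 : 0 < 1 - 1 / q := by
    have : 1 / q < 1 := by rw [div_lt_one hq0]; exact hq
    linarith
  have hp1 : 0 < 1 / p := by positivity
  obtain ⟨p', hp', hpp, hθ'⟩ : ∃ p', 0 < p' ∧ p < p' ∧ 1 < 1 / p' + 1 / q := by
    refine ⟨2 / (1 / p + (1 - 1 / q)), by positivity, ?_, ?_⟩
    · rw [lt_div_iff₀ (by positivity)]
      have : p * (1 / p) = 1 := by field_simp
      have : p * (1 - 1 / q) < p * (1 / p) := mul_lt_mul_of_pos_left (by linarith) hp
      linarith
    · rw [one_div_div]; linarith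
  have hγ : 0 < 1 - p / p' := by
    have : p / p' < 1 := by rw [div_lt_one hp']; exact hpp
    linarith
  have hK : 0 ≤ youngK p' q := zero_le_one.trans (one_le_youngK hθ')
  obtain ⟨o, ho, hoε⟩ := exists_rpow_mul_le (c := youngK p' q * (Q * (W ^ p) ^ (1 / p'))) hγ hε
  obtain ⟨δ, hδ, hosc⟩ := exists_le_of_continuousOn_Icc hω ho
  refine ⟨δ, hδ, fun n u hu h0 hn hfine => le_trans ?_ hoε⟩
  set Wi : ℕ → ℝ := fun i => pVarReal p ω (u i) (u (i + 1)) with hWi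
  set Qi : ℕ → ℝ := fun i => pVarReal q z (u i) (u (i + 1)) with hQi
  have hWi0 : ∀ i, 0 ≤ Wi i := fun i => pVarReal_nonneg _ _ _ _
  have hQi0 : ∀ i, 0 ≤ Qi i := fun i => pVarReal_nonneg _ _ _ _
  calc _ ≤ ∑ i ∈ Finset.range n, (youngK p' q * o ^ (1 - p / p')) *
        ((Qi i ^ q) ^ (1 / q) * (Wi i ^ p) ^ (1 / p')) := by
        refine Finset.sum_le_sum fun i hi => ?_
        have hi := Finset.mem_range.1 hi
        have h1 : s ≤ u i := h0.trans (hu (Nat.zero_le i))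
        have h2 : u i ≤ u (i + 1) := hu (Nat.le_succ i)
        have h3 : u (i + 1) ≤ t := (hu hi).trans hn
        have hWv := ((hW.mono hp hW0 le_rfl h1 h3).varLE_pVarReal hp hW0).of_norm_sub_le_const hp
          hpp.le (pVarReal_nonneg _ _ _ _) ho.le (fun a b ha hab hb =>
            hosc a b (h1.trans ha) hab (hb.trans h3) (by linarith [hfine i hi]))
        have hQv := (hQ.mono hq0 hQ0 le_rfl h1 h3).varLE_pVarReal hq0 hQ0
        refine ((hJ _ _ h1 h2 h3).norm_sub_le hp' hq0 hθ' h2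
          (mul_nonneg (Real.rpow_nonneg (Real.rpow_nonneg (hWi0 i) _) _) (Real.rpow_nonneg ho.le _))
          (pVarReal_nonneg _ _ _ _) hWv hQv).trans (le_of_eq ?_)
        rw [← Real.rpow_mul (hQi0 i), mul_one_div_cancel hq0.ne', Real.rpow_one]
        ring
    _ = (youngK p' q * o ^ (1 - p / p')) *
        ∑ i ∈ Finset.range n, (Qi i ^ q) ^ (1 / q) * (Wi i ^ p) ^ (1 / p') := by
        rw [Finset.mul_sum]
    _ ≤ (youngK p' q * o ^ (1 - p / p')) * ((∑ i ∈ Finset.range n, Qi i ^ q) ^ (1 / q) *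
        (∑ i ∈ Finset.range n, Wi i ^ p) ^ (1 / p')) := by
        have := sum_rpow_mul_rpow_le (Finset.range n) (a := fun i => Qi i ^ q)
          (b := fun i => Wi i ^ p) (α := 1 / q) (β := 1 / p') (by positivity) (by positivity)
          (by linarith) (fun i _ => Real.rpow_nonneg (hQi0 i) _)
          (fun i _ => Real.rpow_nonneg (hWi0 i) _)
        gcongr
    _ ≤ (youngK p' q * o ^ (1 - p / p')) * ((Q ^ q) ^ (1 / q) * (W ^ p) ^ (1 / p')) := by
        have h1 := hQ.sum_pVarReal_rpow_le hq0 hQ0 hu h0 hn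
        have h2 := hW.sum_pVarReal_rpow_le hp hW0 hu h0 hn
        have h3 : 0 ≤ ∑ i ∈ Finset.range n, Qi i ^ q :=
          Finset.sum_nonneg fun i _ => Real.rpow_nonneg (hQi0 i) _
        have h4 : 0 ≤ ∑ i ∈ Finset.range n, Wi i ^ p :=
          Finset.sum_nonneg fun i _ => Real.rpow_nonneg (hWi0 i) _
        gcongr
    _ = _ := by
        rw [← Real.rpow_mul hQ0, mul_one_div_cancel hq0.ne', Real.rpow_one]
        ring

/-! ### Paths driven by a drift and a Young integral -/

/-- On `[s, t]` the continuous path `x` satisfies `dx = g dr + z dω`, with a bounded drift `g`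
and a Young integral. -/
structure IsYoungPath (p q : ℝ) (x g z : ℝ → E) (ω : ℝ → ℝ) (s t : ℝ) : Prop where
  cont : ContinuousOn x (Icc s t)
  cont_driver : ContinuousOn ω (Icc s t)
  var_driver : ∃ W, 0 ≤ W ∧ VarLE p ω s t W
  var : ∃ V, 0 ≤ V ∧ VarLE q x s t V
  var_integrand : ∃ Q, 0 ≤ Q ∧ VarLE q z s t Q
  drift_integrable : IntervalIntegrable g volume s t
  drift_bdd : ∃ B, 0 ≤ B ∧ ∀ r ∈ Icc s t, ‖g r‖ ≤ B
  equation : ∀ a b, s ≤ a → a ≤ b → b ≤ t →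
    HasYoungIntegral z ω a b (x b - x a - ∫ r in a..b, g r)

theorem norm_integral_le_of_Icc {g : ℝ → E} {a b B : ℝ} (hab : a ≤ b)
    (h : ∀ r ∈ Icc a b, ‖g r‖ ≤ B) : ‖∫ r in a..b, g r‖ ≤ B * (b - a) := by
  have := intervalIntegral.norm_integral_le_of_norm_le_const (a := a) (b := b) (f := g) (C := B)
    (fun r hr => by
      rw [uIoc_of_le hab] at hr
      exact h r ⟨hr.1.le, hr.2⟩)
  rwa [abs_of_nonneg (sub_nonneg.2 hab)] at this

theorem IsYoungPath.mono {p q : ℝ} (hp : 0 < p) (hq : 0 < q) {x g z : ℝ → E} {ω : ℝ → ℝ}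
    {s t s' t' : ℝ} (h : IsYoungPath p q x g z ω s t) (hs : s ≤ s') (hst : s' ≤ t')
    (ht : t' ≤ t) : IsYoungPath p q x g z ω s' t' where
  cont := h.cont.mono (Icc_subset_Icc hs ht)
  cont_driver := h.cont_driver.mono (Icc_subset_Icc hs ht)
  var_driver := let ⟨W, h0, hW⟩ := h.var_driver; ⟨W, h0, hW.mono hp h0 le_rfl hs ht⟩
  var := let ⟨W, h0, hW⟩ := h.var; ⟨W, h0, hW.mono hq h0 le_rfl hs ht⟩
  var_integrand := let ⟨W, h0, hW⟩ := h.var_integrand; ⟨W, h0, hW.mono hq h0 le_rfl hs ht⟩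
  drift_integrable := h.drift_integrable.mono_set (by
    rw [uIcc_of_le hst, uIcc_of_le (hs.trans (hst.trans ht))]; exact Icc_subset_Icc hs ht)
  drift_bdd := let ⟨B, h0, hB⟩ := h.drift_bdd
    ⟨B, h0, fun r hr => hB r (Icc_subset_Icc hs ht hr)⟩
  equation := fun a b ha hab hb => h.equation a b (hs.trans ha) hab (hb.trans ht)

/-- The quadratic variation vanishes: the path inherits finite `p`-variation, `p < 2`, from its
driver. -/
theorem IsYoungPath.exists_sum_sq_le {p q : ℝ} (hp1 : 1 ≤ p) (hp2 : p < 2) (hq : 0 < q)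
    (hθ : 1 < 1 / p + 1 / q) {x g z : ℝ → E} {ω : ℝ → ℝ} {s t : ℝ}
    (h : IsYoungPath p q x g z ω s t) {ε : ℝ} (hε : 0 < ε) :
    ∃ δ > 0, ∀ (n : ℕ) (u : ℕ → ℝ), Monotone u → s ≤ u 0 → u n ≤ t →
      (∀ i < n, u (i + 1) - u i < δ) →
      ∑ i ∈ Finset.range n, ‖x (u (i + 1)) - x (u i)‖ ^ 2 ≤ ε := by
  have hp0 : 0 < p := by linarith
  obtain ⟨W, hW0, hW⟩ := h.var_driver
  obtain ⟨Q, hQ0, hQ⟩ := h.var_integrand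
  obtain ⟨B, hB0, hB⟩ := h.drift_bdd
  have hK : 0 ≤ youngK p q := zero_le_one.trans (one_le_youngK hθ)
  set c := ‖z s‖ + Q + youngK p q * Q with hc
  have hc0 : 0 ≤ c := by positivity
  have hinc : ∀ a b, s ≤ a → a ≤ b → b ≤ t →
      ‖x b - x a‖ ≤ B * (b - a) + c * pVarReal p ω a b := by
    intro a b ha hab hb
    have hWv := (hW.mono hp0 hW0 le_rfl ha hb).varLE_pVarReal hp0 hW0
    have hw0 := pVarReal_nonneg p ω a b
    have h1 := (h.equation a b ha hab hb).norm_sub_le hp0 hq hθ hab hw0 hQ0 hWv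
      (hQ.mono hq hQ0 le_rfl ha hb)
    have h2 := norm_integral_le_of_Icc hab fun r hr => hB r ⟨ha.trans hr.1, hr.2.trans hb⟩
    have h3 : ‖z a‖ ≤ ‖z s‖ + Q := by
      have := hQ.norm_sub_le hq hQ0 le_rfl ha (hab.trans hb)
      calc ‖z a‖ = ‖z s + (z a - z s)‖ := by congr 1; abel
        _ ≤ _ := (norm_add_le _ _).trans (by gcongr)
    have h4 : ‖(ω b - ω a) • z a‖ ≤ pVarReal p ω a b * (‖z s‖ + Q) := by
      rw [norm_smul]
      exact mul_le_mul (hWv.norm_sub_le hp0 hw0 le_rfl hab le_rfl) h3 (norm_nonneg _) hw0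
    calc ‖x b - x a‖ = ‖(∫ r in a..b, g r) + (ω b - ω a) • z a +
          (x b - x a - (∫ r in a..b, g r) - (ω b - ω a) • z a)‖ := by congr 1; abel
      _ ≤ _ := norm_add₃_le
      _ ≤ B * (b - a) + pVarReal p ω a b * (‖z s‖ + Q) +
          youngK p q * (Q * pVarReal p ω a b) := by gcongr
      _ = _ := by rw [hc]; ring
  set M := (B * (t - s) + c * W) ^ p with hM
  obtain ⟨o, ho, hoε⟩ := exists_rpow_mul_le (c := M) (γ := 2 - p) (by linarith) hε
  obtain ⟨δ, hδ, hosc⟩ := exists_le_of_continuousOn_Icc h.cont ho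
  refine ⟨δ, hδ, fun n u hu h0 hn hfine => le_trans ?_ hoε⟩
  have hmem : ∀ i < n, s ≤ u i ∧ u i ≤ u (i + 1) ∧ u (i + 1) ≤ t := fun i hi =>
    ⟨h0.trans (hu (Nat.zero_le i)), hu (Nat.le_succ i), (hu hi).trans hn⟩
  calc _ ≤ ∑ i ∈ Finset.range n, (B * (u (i + 1) - u i) +
        c * pVarReal p ω (u i) (u (i + 1))) ^ p * o ^ (2 - p) := by
        refine Finset.sum_le_sum fun i hi => ?_
        obtain ⟨h1, h2, h3⟩ := hmem i (Finset.mem_range.1 hi)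
        have e1 := hinc _ _ h1 h2 h3
        have e2 := hosc _ _ h1 h2 h3 (hfine i (Finset.mem_range.1 hi))
        calc ‖x (u (i + 1)) - x (u i)‖ ^ 2
            = ‖x (u (i + 1)) - x (u i)‖ ^ p * ‖x (u (i + 1)) - x (u i)‖ ^ (2 - p) := by
              rw [← Real.rpow_add_of_nonneg (norm_nonneg _) hp0.le (by linarith),
                ← Real.rpow_natCast]
              congr 1
              push_cast
              ring
          _ ≤ _ := by
              have h4 : 0 ≤ 2 - p := by linarith
              have h5 := (norm_nonneg _).trans e1
              gcongr
    _ ≤ M * o ^ (2 - p) := by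
        rw [← Finset.sum_mul]
        have := hW.sum_linear_add_rpow_le hp1 hW0 hB0 hc0 hu h0 hn
        gcongr

theorem IsYoungPath.exists_partition {p q : ℝ} (hp1 : 1 ≤ p) (hp2 : p < 2) (hq : 1 < q)
    (hθ : 1 < 1 / p + 1 / q) {x g z : ℝ → E} {ω : ℝ → ℝ} {s t : ℝ} (hst : s ≤ t)
    (h : IsYoungPath p q x g z ω s t) {ε δ : ℝ} (hε : 0 < ε) (hδ : 0 < δ) :
    ∃ (n : ℕ) (u : ℕ → ℝ), Monotone u ∧ u 0 = s ∧ u n = t ∧ (∀ i, u (i + 1) - u i < δ) ∧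
      ∑ i ∈ Finset.range n, ‖x (u (i + 1)) - x (u i)‖ ^ 2 ≤ ε ∧
      ∑ i ∈ Finset.range n, ‖x (u (i + 1)) - x (u i) - (∫ r in (u i)..(u (i + 1)), g r) -
        (ω (u (i + 1)) - ω (u i)) • z (u i)‖ ≤ ε := by
  obtain ⟨W, hW0, hW⟩ := h.var_driver
  obtain ⟨Q, hQ0, hQ⟩ := h.var_integrand
  have hint : ∀ a b, s ≤ a → a ≤ b → b ≤ t → IntervalIntegrable g volume a b :=
    fun a b ha hab hb => h.drift_integrable.mono_set (by
      rw [uIcc_of_le hab, uIcc_of_le hst]; exact Icc_subset_Icc ha hb)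
  have hJ : ∀ a b, s ≤ a → a ≤ b → b ≤ t → (x b - ∫ r in s..b, g r) - (x a - ∫ r in s..a, g r) =
      x b - x a - ∫ r in a..b, g r := by
    intro a b ha hab hb
    rw [← intervalIntegral.integral_add_adjacent_intervals (hint s a le_rfl ha (hab.trans hb))
      (hint a b ha hab hb)]
    abel
  obtain ⟨δ₁, hδ₁, h1⟩ := h.exists_sum_sq_le hp1 hp2 (by linarith) hθ hε
  obtain ⟨δ₂, hδ₂, h2⟩ := exists_sum_norm_sub_le (by linarith) hq hθ hW0 hQ0 h.cont_driver hW hQ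
    (J := fun b => x b - ∫ r in s..b, g r)
    (fun a b ha hab hb => by rw [hJ a b ha hab hb]; exact h.equation a b ha hab hb) hε
  obtain ⟨n, u, hu, hu0, hun, hfine⟩ := exists_fine_partition hst (lt_min hδ (lt_min hδ₁ hδ₂))
  refine ⟨n, u, hu, hu0, hun, fun i => (hfine i).trans_le (min_le_left _ _),
    h1 n u hu hu0.ge hun.le fun i _ =>
      (hfine i).trans_le ((min_le_right _ _).trans (min_le_left _ _)), ?_⟩
  have := h2 n u hu hu0.ge hun.le fun i _ =>
      (hfine i).trans_le ((min_le_right _ _).trans (min_le_right _ _))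
  refine le_of_eq_of_le (Finset.sum_congr rfl fun i hi => ?_) this
  rw [hJ _ _ (hu0.ge.trans (hu (Nat.zero_le i))) (hu (Nat.le_succ i))
    ((hu (Finset.mem_range.1 hi)).trans hun.le)]

end

section

variable {E : Type*} [NormedAddCommGroup E] [InnerProductSpace ℝ E]

/-! ### Logarithm of the norm and direction of a vector -/

theorem log_norm_sub_log_norm_le {a b : E} (ha : a ≠ 0) (hb : b ≠ 0) :
    Real.log ‖b‖ - Real.log ‖a‖ ≤
      inner ℝ ((‖a‖ ^ 2)⁻¹ • a) (b - a) + ‖b - a‖ ^ 2 / (2 * ‖a‖ ^ 2) := by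
  have ha' : 0 < ‖a‖ := norm_pos_iff.2 ha
  have hb' : 0 < ‖b‖ := norm_pos_iff.2 hb
  have h1 : Real.log ‖b‖ - Real.log ‖a‖ = Real.log ((‖b‖ / ‖a‖) ^ 2) / 2 := by
    rw [Real.log_pow, Real.log_div hb'.ne' ha'.ne']
    push_cast
    ring
  have h2 := Real.log_le_sub_one_of_pos (show 0 < (‖b‖ / ‖a‖) ^ 2 by positivity)
  have h3 : ‖b‖ ^ 2 = ‖a‖ ^ 2 + 2 * inner ℝ a (b - a) + ‖b - a‖ ^ 2 := by
    rw [← norm_add_sq_real]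
    congr 2
    abel
  rw [h1, real_inner_smul_left]
  calc Real.log ((‖b‖ / ‖a‖) ^ 2) / 2 ≤ ((‖b‖ / ‖a‖) ^ 2 - 1) / 2 := by linarith
    _ = _ := by
      rw [div_pow, h3]
      field_simp
      ring

/-- The component of `v` orthogonal to the unit vector `y`. -/
def orthComp (y v : E) : E := v - inner ℝ y v • y

theorem norm_orthComp_le {y : E} (hy : ‖y‖ = 1) (v : E) : ‖orthComp y v‖ ≤ ‖v‖ := by
  have h : ‖orthComp y v‖ ^ 2 = ‖v‖ ^ 2 - (inner ℝ y v) ^ 2 := by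
    rw [orthComp, norm_sub_sq_real, norm_smul, hy, real_inner_smul_right, real_inner_comm,
      Real.norm_eq_abs, mul_one, sq_abs]
    ring
  refine le_of_sq_le_sq ?_ (norm_nonneg _)
  rw [h]
  nlinarith [sq_nonneg (inner ℝ y v)]

theorem orthComp_add (y v w : E) : orthComp y (v + w) = orthComp y v + orthComp y w := by
  simp only [orthComp, inner_add_right]
  module

theorem orthComp_smul (y v : E) (c : ℝ) : orthComp y (c • v) = c • orthComp y v := by
  simp only [orthComp, real_inner_smul_right]
  module

theorem norm_orthComp_sub_le {y y' : E} (hy : ‖y‖ = 1) (hy' : ‖y'‖ = 1) (v : E) :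
    ‖orthComp y' v - orthComp y v‖ ≤ 2 * (‖y' - y‖ * ‖v‖) := by
  have e : orthComp y' v - orthComp y v = -(inner ℝ (y' - y) v • y' + inner ℝ y v • (y' - y)) := by
    simp only [orthComp, inner_sub_left]
    module
  rw [e, norm_neg]
  refine (norm_add_le _ _).trans ?_
  rw [norm_smul, norm_smul, hy', mul_one, Real.norm_eq_abs, Real.norm_eq_abs]
  have h1 := abs_real_inner_le_norm (y' - y) v
  have h2 := mul_le_mul_of_nonneg_right (abs_real_inner_le_norm y v) (norm_nonneg (y' - y))
  rw [hy, one_mul] at h2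
  linarith

/-- The direction `v / ‖v‖`. -/
def direction (v : E) : E := ‖v‖⁻¹ • v

theorem norm_direction {v : E} (hv : v ≠ 0) : ‖direction v‖ = 1 := by
  rw [direction, norm_smul, norm_inv, norm_norm, inv_mul_cancel₀ (norm_ne_zero_iff.2 hv)]

theorem norm_smul_direction {v : E} (hv : v ≠ 0) : ‖v‖ • direction v = v := by
  rw [direction, smul_smul, mul_inv_cancel₀ (norm_ne_zero_iff.2 hv), one_smul]

theorem direction_sub_eq {a b : E} (ha : a ≠ 0) (hb : b ≠ 0) :
    ‖a‖ • (direction b - direction a) = (b - a) - (‖b‖ - ‖a‖) • direction b := by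
  rw [smul_sub, norm_smul_direction ha, sub_smul, norm_smul_direction hb]
  abel

theorem norm_direction_sub_le {a b : E} (ha : a ≠ 0) (hb : b ≠ 0) :
    ‖direction b - direction a‖ ≤ 2 * ‖b - a‖ / ‖a‖ := by
  have ha' : 0 < ‖a‖ := norm_pos_iff.2 ha
  rw [le_div_iff₀ ha', mul_comm, ← norm_norm a, ← norm_smul, direction_sub_eq ha hb]
  refine (norm_sub_le _ _).trans ?_
  rw [norm_smul, norm_direction hb, mul_one]
  have := abs_norm_sub_norm_le b a
  rw [Real.norm_eq_abs]
  linarith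

/-- Second order expansion of the direction. -/
theorem norm_direction_sub_sub_le {a b : E} (ha : a ≠ 0) (hb : b ≠ 0) :
    ‖direction b - direction a - ‖a‖⁻¹ • orthComp (direction a) (b - a)‖ ≤
      5 / 2 * ‖b - a‖ ^ 2 / ‖a‖ ^ 2 := by
  have ha' : 0 < ‖a‖ := norm_pos_iff.2 ha
  set ν := inner ℝ (direction a) (b - a) with hν
  have hna : inner ℝ (direction a) a = ‖a‖ := by
    rw [direction, real_inner_smul_left, real_inner_self_eq_norm_sq]
    field_simp
  have e : ‖a‖ • (direction b - direction a - ‖a‖⁻¹ • orthComp (direction a) (b - a)) =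
      -(‖b‖ - ‖a‖ - ν) • direction b - ν • (direction b - direction a) := by
    rw [smul_sub, direction_sub_eq ha hb, smul_smul, mul_inv_cancel₀ ha'.ne', one_smul, orthComp,
      ← hν]
    module
  have hν1 : |ν| ≤ ‖b - a‖ := by
    have := abs_real_inner_le_norm (direction a) (b - a)
    rwa [norm_direction ha, one_mul] at this
  have hlow : 0 ≤ ‖b‖ - ‖a‖ - ν := by
    have := real_inner_le_norm (direction a) b
    rw [norm_direction ha, one_mul] at this
    rw [hν, inner_sub_right, hna]
    linarith
  have hup : (‖b‖ - ‖a‖ - ν) * ‖a‖ ≤ ‖b - a‖ ^ 2 / 2 := by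
    have h3 : ‖b‖ ^ 2 = ‖a‖ ^ 2 + 2 * (‖a‖ * ν) + ‖b - a‖ ^ 2 := by
      have : ‖a‖ * ν = inner ℝ a (b - a) := by
        rw [hν, ← real_inner_smul_left, norm_smul_direction ha]
      rw [this, ← norm_add_sq_real]
      congr 2
      abel
    nlinarith [sq_nonneg (‖b‖ - ‖a‖)]
  have h2 := norm_direction_sub_le ha hb
  have h4 : ‖a‖ * ‖direction b - direction a - ‖a‖⁻¹ • orthComp (direction a) (b - a)‖ ≤
      (‖b‖ - ‖a‖ - ν) + ‖b - a‖ * (2 * ‖b - a‖ / ‖a‖) := by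
    rw [show ‖a‖ * ‖direction b - direction a - ‖a‖⁻¹ • orthComp (direction a) (b - a)‖ =
      ‖‖a‖ • (direction b - direction a - ‖a‖⁻¹ • orthComp (direction a) (b - a))‖ by
        rw [norm_smul, norm_norm], e]
    refine (norm_sub_le _ _).trans ?_
    rw [norm_smul, norm_smul, norm_neg, norm_direction hb, mul_one, Real.norm_of_nonneg hlow,
      Real.norm_eq_abs ν]
    gcongr
  rw [le_div_iff₀ (by positivity)]
  calc _ = (‖a‖ * ‖direction b - direction a - ‖a‖⁻¹ • orthComp (direction a) (b - a)‖) * ‖a‖ := by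
        ring
    _ ≤ ((‖b‖ - ‖a‖ - ν) + ‖b - a‖ * (2 * ‖b - a‖ / ‖a‖)) * ‖a‖ := by gcongr
    _ = (‖b‖ - ‖a‖ - ν) * ‖a‖ + 2 * ‖b - a‖ ^ 2 := by field_simp
    _ ≤ _ := by linarith

end

section

/-! ### Growth and rotation of a path driven by a Young integral -/

theorem exists_pos_le_norm {E : Type*} [NormedAddCommGroup E] {x : ℝ → E} {s t : ℝ} (hst : s ≤ t)
    (hx : ContinuousOn x (Icc s t)) (h0 : ∀ r ∈ Icc s t, x r ≠ 0) :
    ∃ m > 0, ∀ r ∈ Icc s t, m ≤ ‖x r‖ := by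
  obtain ⟨r, hr, hmin⟩ := isCompact_Icc.exists_isMinOn (nonempty_Icc.2 hst) hx.norm
  exact ⟨‖x r‖, norm_pos_iff.2 (h0 r hr), fun r' hr' => hmin hr'⟩

variable {E : Type*} [NormedAddCommGroup E] [InnerProductSpace ℝ E]

/-- Upper bound for the growth of the norm of a path away from zero. Along a partition the
increments of `log ‖x‖` are bounded by the tangential increments of `x`; the drift contributes
`∫ κ`, and the Young inequality bounds the Riemann sum of the noise. -/
theorem IsYoungPath.log_norm_sub_le [CompleteSpace E] {p q : ℝ} (hp1 : 1 ≤ p) (hp2 : p < 2)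
    (hq : 1 < q)
    (hθ : 1 < 1 / p + 1 / q) {x g z : ℝ → E} {ω : ℝ → ℝ} {s t : ℝ} (hst : s ≤ t)
    (h : IsYoungPath p q x g z ω s t) (h0 : ∀ r ∈ Icc s t, x r ≠ 0)
    {κ : ℝ → ℝ} (hκ : IntervalIntegrable κ volume s t)
    (hgκ : ∀ r ∈ Icc s t, inner ℝ (x r) (g r) ≤ κ r * ‖x r‖ ^ 2)
    {W V e : ℝ} (hW0 : 0 ≤ W) (hV0 : 0 ≤ V) (hW : VarLE p ω s t W)
    (hV : VarLE q (fun r => inner ℝ ((‖x r‖ ^ 2)⁻¹ • x r) (z r)) s t V)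
    (he : |inner ℝ ((‖x s‖ ^ 2)⁻¹ • x s) (z s)| ≤ e) :
    Real.log ‖x t‖ - Real.log ‖x s‖ ≤ (∫ r in s..t, κ r) + W * (e + youngK p q * V) := by
  have hp0 : 0 < p := by linarith
  have hq0 : 0 < q := by linarith
  obtain ⟨m, hm, hmx⟩ := exists_pos_le_norm hst h.cont h0
  obtain ⟨B, hB0, hB⟩ := h.drift_bdd
  set N : ℝ → E := fun r => (‖x r‖ ^ 2)⁻¹ • x r with hN
  have hNc : ContinuousOn N (Icc s t) :=
    ((h.cont.norm.pow 2).inv₀ fun r hr => pow_ne_zero 2 (norm_ne_zero_iff.2 (h0 r hr))).smul h.cont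
  have hNm : ∀ r ∈ Icc s t, ‖N r‖ ≤ 1 / m := by
    intro r hr
    have h1 := norm_pos_iff.2 (h0 r hr)
    simp only [hN]
    rw [norm_smul, norm_inv, norm_pow, norm_norm,
      show (‖x r‖ ^ 2)⁻¹ * ‖x r‖ = 1 / ‖x r‖ by field_simp]
    exact one_div_le_one_div_of_le hm (hmx r hr)
  have hNg : ∀ r ∈ Icc s t, inner ℝ (N r) (g r) ≤ κ r := by
    intro r hr
    have h1 := norm_pos_iff.2 (h0 r hr)
    simp only [hN]
    rw [real_inner_smul_left, inv_mul_le_iff₀ (by positivity), mul_comm]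
    exact hgκ r hr
  set c := B * (t - s) + 1 / m + 1 / (2 * m ^ 2) with hc
  have hc0 : 0 ≤ c := by
    have : 0 ≤ t - s := by linarith
    positivity
  -- an error `c ε` for every `ε`
  suffices H : ∀ ε > 0, Real.log ‖x t‖ - Real.log ‖x s‖ ≤
      (∫ r in s..t, κ r) + W * (e + youngK p q * V) + c * ε by
    refine le_of_forall_pos_le_add fun η hη => ?_
    have := H (η / (c + 1)) (by positivity)
    have h2 : c * (η / (c + 1)) ≤ η := by
      rw [mul_div_assoc', div_le_iff₀ (by positivity)]
      nlinarith
    linarith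
  intro ε hε
  obtain ⟨δ, hδ, hosc⟩ := exists_le_of_continuousOn_Icc hNc hε
  obtain ⟨n, u, hu, hu0, hun, hfine, hsq, hrem⟩ := h.exists_partition hp1 hp2 hq hθ hst hε hδ
  have hmem : ∀ i < n, s ≤ u i ∧ u i ≤ u (i + 1) ∧ u (i + 1) ≤ t := fun i hi =>
    ⟨hu0.ge.trans (hu (Nat.zero_le i)), hu (Nat.le_succ i), (hu hi).trans hun.le⟩
  have hsub : ∀ i < n, uIcc (u i) (u (i + 1)) ⊆ uIcc s t := by
    intro i hi
    obtain ⟨h1, h2, h3⟩ := hmem i hi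
    rw [uIcc_of_le h2, uIcc_of_le hst]
    exact Icc_subset_Icc h1 h3
  set Δ : ℕ → E := fun i => x (u (i + 1)) - x (u i) with hΔ
  set R : ℕ → E := fun i => x (u (i + 1)) - x (u i) - (∫ r in (u i)..(u (i + 1)), g r) -
        (ω (u (i + 1)) - ω (u i)) • z (u i) with hR
  have hdrift : ∀ i < n, inner ℝ (N (u i)) (∫ r in (u i)..(u (i + 1)), g r) ≤
      (∫ r in (u i)..(u (i + 1)), κ r) + B * ε * (u (i + 1) - u i) := by
    intro i hi
    obtain ⟨h1, h2, h3⟩ := hmem i hi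
    have hgi := h.drift_integrable.mono_set (hsub i hi)
    have hκi := hκ.mono_set (hsub i hi)
    have e1 := (innerSL ℝ (N (u i))).intervalIntegral_comp_comm hgi
    simp only [innerSL_apply_apply] at e1
    rw [← e1]
    have e2 : (∫ r in (u i)..(u (i + 1)), κ r) + B * ε * (u (i + 1) - u i) =
        ∫ r in (u i)..(u (i + 1)), (κ r + B * ε) := by
      rw [intervalIntegral.integral_add hκi intervalIntegrable_const,
        intervalIntegral.integral_const, smul_eq_mul]
      ring
    rw [e2]
    have hint1 : IntervalIntegrable (fun r => inner ℝ (N (u i)) (g r)) volume (u i) (u (i + 1)) :=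
      ⟨(innerSL ℝ (N (u i))).integrable_comp hgi.1, (innerSL ℝ (N (u i))).integrable_comp hgi.2⟩
    refine intervalIntegral.integral_mono_on h2 hint1 (hκi.add intervalIntegrable_const)
      fun r hr => ?_
    have hr' : r ∈ Icc s t := ⟨h1.trans hr.1, hr.2.trans h3⟩
    have e3 : inner ℝ (N (u i)) (g r) = inner ℝ (N r) (g r) - inner ℝ (N r - N (u i)) (g r) := by
      rw [inner_sub_left]; ring
    have e4 := abs_le.1 (abs_real_inner_le_norm (N r - N (u i)) (g r))
    have e5 : ‖N r - N (u i)‖ * ‖g r‖ ≤ ε * B :=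
      mul_le_mul (hosc _ _ h1 hr.1 hr'.2 (by linarith [hfine i, hr.2])) (hB r hr')
        (norm_nonneg _) hε.le
    rw [e3]
    linarith [hNg r hr', e4.1]
  have hstep : ∀ i < n, Real.log ‖x (u (i + 1))‖ - Real.log ‖x (u i)‖ ≤
      (ω (u (i + 1)) - ω (u i)) • inner ℝ (N (u i)) (z (u i)) +
      ((∫ r in (u i)..(u (i + 1)), κ r) + B * ε * (u (i + 1) - u i)) +
      1 / m * ‖R i‖ + 1 / (2 * m ^ 2) * ‖Δ i‖ ^ 2 := by
    intro i hi
    obtain ⟨h1, h2, h3⟩ := hmem i hi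
    have hi1 : u i ∈ Icc s t := ⟨h1, h2.trans h3⟩
    have hi2 : u (i + 1) ∈ Icc s t := ⟨h1.trans h2, h3⟩
    refine (log_norm_sub_log_norm_le (h0 _ hi1) (h0 _ hi2)).trans ?_
    have e1 : x (u (i + 1)) - x (u i) = R i + (∫ r in (u i)..(u (i + 1)), g r) +
        (ω (u (i + 1)) - ω (u i)) • z (u i) := by simp only [hR]; abel
    have e2 : inner ℝ (N (u i)) (R i) ≤ 1 / m * ‖R i‖ :=
      (real_inner_le_norm _ _).trans (mul_le_mul_of_nonneg_right (hNm _ hi1) (norm_nonneg _))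
    have e3 : ‖x (u (i + 1)) - x (u i)‖ ^ 2 / (2 * ‖x (u i)‖ ^ 2) ≤
        1 / (2 * m ^ 2) * ‖Δ i‖ ^ 2 := by
      rw [div_eq_mul_one_div, mul_comm]
      have := hmx _ hi1
      gcongr
    have e4 : inner ℝ (N (u i)) (x (u (i + 1)) - x (u i)) =
        inner ℝ (N (u i)) (R i) + inner ℝ (N (u i)) (∫ r in (u i)..(u (i + 1)), g r) +
        (ω (u (i + 1)) - ω (u i)) • inner ℝ (N (u i)) (z (u i)) := by
      rw [e1, inner_add_right, inner_add_right, real_inner_smul_right, smul_eq_mul]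
    have e5 := hdrift i hi
    change inner ℝ (N (u i)) (x (u (i + 1)) - x (u i)) + _ ≤ _
    rw [e4]
    linarith
  have hsum := Finset.sum_le_sum fun i (hi : i ∈ Finset.range n) =>
    hstep i (Finset.mem_range.1 hi)
  rw [Finset.sum_range_sub (fun i => Real.log ‖x (u i)‖), hu0, hun, Finset.sum_add_distrib,
    Finset.sum_add_distrib, Finset.sum_add_distrib, Finset.sum_add_distrib, ← Finset.mul_sum,
    ← Finset.mul_sum, ← Finset.mul_sum, Finset.sum_range_sub, hu0, hun,
    intervalIntegral.sum_integral_adjacent_intervals fun i hi => hκ.mono_set (hsub i hi),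
    hu0, hun] at hsum
  have hyoung := norm_youngSum_sub_le_youngK hp0 hq0 hθ hW0 hV0 hW hV hu hu0.ge hun.le
  rw [hu0, hun] at hyoung
  have hy1 : youngSum (fun r => inner ℝ (N r) (z r)) ω n u ≤ W * (e + youngK p q * V) := by
    have a1 : |(ω t - ω s) • inner ℝ (N s) (z s)| ≤ W * e := by
      rw [smul_eq_mul, abs_mul]
      exact mul_le_mul (hW.norm_sub_le hp0 hW0 le_rfl hst le_rfl) he (abs_nonneg _) hW0
    have a2 := (abs_le.1 a1).2
    have a3 := (abs_le.1 hyoung).2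
    linarith
  have hr1 : 1 / m * ∑ i ∈ Finset.range n, ‖R i‖ ≤ 1 / m * ε := by gcongr
  have hr2 : 1 / (2 * m ^ 2) * ∑ i ∈ Finset.range n, ‖Δ i‖ ^ 2 ≤ 1 / (2 * m ^ 2) * ε := by gcongr
  unfold youngSum at hy1
  calc _ ≤ _ := hsum
    _ ≤ W * (e + youngK p q * V) + ((∫ r in s..t, κ r) + B * ε * (t - s)) + 1 / m * ε +
        1 / (2 * m ^ 2) * ε := by gcongr
    _ = _ := by rw [hc]; ring

/-- The direction of the path moves by the orthogonal components of the drift and of the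
noise. -/
theorem IsYoungPath.norm_direction_sub_le {p q : ℝ} (hp1 : 1 ≤ p) (hp2 : p < 2) (hq : 1 < q)
    (hθ : 1 < 1 / p + 1 / q) {x g z : ℝ → E} {ω : ℝ → ℝ} {s t : ℝ} (hst : s ≤ t)
    (h : IsYoungPath p q x g z ω s t) (h0 : ∀ r ∈ Icc s t, x r ≠ 0)
    {a : ℝ} (ha : 0 ≤ a) (hga : ∀ r ∈ Icc s t, ‖g r‖ ≤ a * ‖x r‖)
    {W V c : ℝ} (hW0 : 0 ≤ W) (hV0 : 0 ≤ V) (hW : VarLE p ω s t W)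
    (hV : VarLE q (fun r => ‖x r‖⁻¹ • orthComp (direction (x r)) (z r)) s t V)
    (hc : ‖‖x s‖⁻¹ • orthComp (direction (x s)) (z s)‖ ≤ c) :
    ‖direction (x t) - direction (x s)‖ ≤ a * (t - s) + W * (c + youngK p q * V) := by
  have hp0 : 0 < p := by linarith
  have hq0 : 0 < q := by linarith
  obtain ⟨m, hm, hmx⟩ := exists_pos_le_norm hst h.cont h0
  set D : ℝ → E := fun r => ‖x r‖⁻¹ • orthComp (direction (x r)) (z r) with hD
  set C := 1 / m + a * (t - s) + 5 / 2 / m ^ 2 with hC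
  have hC0 : 0 ≤ C := by
    have : 0 ≤ t - s := by linarith
    positivity
  suffices H : ∀ ε > 0, ‖direction (x t) - direction (x s)‖ ≤
      a * (t - s) + W * (c + youngK p q * V) + C * ε by
    refine le_of_forall_pos_le_add fun η hη => ?_
    have := H (η / (C + 1)) (by positivity)
    have h2 : C * (η / (C + 1)) ≤ η := by
      rw [mul_div_assoc', div_le_iff₀ (by positivity)]
      nlinarith
    linarith
  intro ε hε
  obtain ⟨δ, hδ, hosc⟩ := exists_le_of_continuousOn_Icc h.cont (show 0 < ε * m by positivity)
  obtain ⟨n, u, hu, hu0, hun, hfine, hsq, hrem⟩ := h.exists_partition hp1 hp2 hq hθ hst hε hδ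
  have hmem : ∀ i < n, s ≤ u i ∧ u i ≤ u (i + 1) ∧ u (i + 1) ≤ t := fun i hi =>
    ⟨hu0.ge.trans (hu (Nat.zero_le i)), hu (Nat.le_succ i), (hu hi).trans hun.le⟩
  set Δ : ℕ → E := fun i => x (u (i + 1)) - x (u i) with hΔ
  set R : ℕ → E := fun i => x (u (i + 1)) - x (u i) - (∫ r in (u i)..(u (i + 1)), g r) -
        (ω (u (i + 1)) - ω (u i)) • z (u i) with hR
  have hstep : ∀ i < n, ‖direction (x (u (i + 1))) - direction (x (u i)) -
      (ω (u (i + 1)) - ω (u i)) • D (u i)‖ ≤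
      1 / m * ‖R i‖ + a * (1 + ε) * (u (i + 1) - u i) + 5 / 2 / m ^ 2 * ‖Δ i‖ ^ 2 := by
    intro i hi
    obtain ⟨h1, h2, h3⟩ := hmem i hi
    have hi1 : u i ∈ Icc s t := ⟨h1, h2.trans h3⟩
    have hi2 : u (i + 1) ∈ Icc s t := ⟨h1.trans h2, h3⟩
    have hρ := norm_pos_iff.2 (h0 _ hi1)
    have hm1 := hmx _ hi1
    have hP := norm_orthComp_le (norm_direction (h0 _ hi1))
    set I := ∫ r in (u i)..(u (i + 1)), g r with hI
    have e1 : x (u (i + 1)) - x (u i) = R i + I + (ω (u (i + 1)) - ω (u i)) • z (u i) := by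
      simp only [hR, hI]; abel
    have e2 := norm_direction_sub_sub_le (h0 _ hi1) (h0 _ hi2)
    have e3 : ‖x (u i)‖⁻¹ • orthComp (direction (x (u i))) (x (u (i + 1)) - x (u i)) =
        ‖x (u i)‖⁻¹ • orthComp (direction (x (u i))) (R i) +
        ‖x (u i)‖⁻¹ • orthComp (direction (x (u i))) I +
        (ω (u (i + 1)) - ω (u i)) • D (u i) := by
      rw [e1, orthComp_add, orthComp_add, orthComp_smul]
      simp only [hD]
      module
    rw [e3] at e2
    have e4 : ‖‖x (u i)‖⁻¹ • orthComp (direction (x (u i))) (R i)‖ ≤ 1 / m * ‖R i‖ := by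
      rw [norm_smul, norm_inv, norm_norm, one_div]
      have := hP (R i)
      gcongr
    have e5 : ‖I‖ ≤ a * ((1 + ε) * ‖x (u i)‖) * (u (i + 1) - u i) := by
      refine norm_integral_le_of_Icc h2 fun r hr => ?_
      have hr' : r ∈ Icc s t := ⟨h1.trans hr.1, hr.2.trans h3⟩
      refine (hga r hr').trans (mul_le_mul_of_nonneg_left ?_ ha)
      have e6 := hosc _ _ h1 hr.1 hr'.2 (by linarith [hfine i, hr.2])
      have e7 := norm_sub_norm_le (x r) (x (u i))
      nlinarith
    have e6 : ‖‖x (u i)‖⁻¹ • orthComp (direction (x (u i))) I‖ ≤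
        a * (1 + ε) * (u (i + 1) - u i) := by
      rw [norm_smul, norm_inv, norm_norm, inv_mul_le_iff₀ hρ]
      refine (hP I).trans (e5.trans (le_of_eq ?_))
      ring
    have e7 : 5 / 2 * ‖x (u (i + 1)) - x (u i)‖ ^ 2 / ‖x (u i)‖ ^ 2 ≤
        5 / 2 / m ^ 2 * ‖Δ i‖ ^ 2 := by
      rw [show 5 / 2 / m ^ 2 * ‖Δ i‖ ^ 2 = 5 / 2 * ‖Δ i‖ ^ 2 / m ^ 2 by ring]
      gcongr
    have e8 : ∀ d w r i' : E, d - w = (d - (r + i' + w)) + r + i' := by intros; abel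
    rw [e8 _ _ (‖x (u i)‖⁻¹ • orthComp (direction (x (u i))) (R i))
      (‖x (u i)‖⁻¹ • orthComp (direction (x (u i))) I)]
    refine norm_add₃_le.trans ?_
    linarith
  have hyoung := norm_youngSum_sub_le_youngK hp0 hq0 hθ hW0 hV0 hW hV hu hu0.ge hun.le
  rw [hu0, hun] at hyoung
  have hy1 : ‖youngSum D ω n u‖ ≤ W * (c + youngK p q * V) := by
    have a1 : ‖(ω t - ω s) • D s‖ ≤ W * c := by
      rw [norm_smul]
      exact mul_le_mul (hW.norm_sub_le hp0 hW0 le_rfl hst le_rfl) hc (norm_nonneg _) hW0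
    calc _ = ‖(ω t - ω s) • D s + (youngSum D ω n u - (ω t - ω s) • D s)‖ := by congr 1; abel
      _ ≤ _ := norm_add_le _ _
      _ ≤ W * c + youngK p q * (V * W) := add_le_add a1 hyoung
      _ = _ := by ring
  have hsum : direction (x t) - direction (x s) = youngSum D ω n u +
      ∑ i ∈ Finset.range n, (direction (x (u (i + 1))) - direction (x (u i)) -
        (ω (u (i + 1)) - ω (u i)) • D (u i)) := by
    rw [Finset.sum_sub_distrib, Finset.sum_range_sub (fun i => direction (x (u i))), hu0, hun,
      youngSum]
    abel
  have hrest : ‖∑ i ∈ Finset.range n, (direction (x (u (i + 1))) - direction (x (u i)) -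
        (ω (u (i + 1)) - ω (u i)) • D (u i))‖ ≤
      1 / m * ε + a * (1 + ε) * (t - s) + 5 / 2 / m ^ 2 * ε := by
    refine (norm_sum_le_of_le _ fun i hi => hstep i (Finset.mem_range.1 hi)).trans ?_
    rw [Finset.sum_add_distrib, Finset.sum_add_distrib, ← Finset.mul_sum, ← Finset.mul_sum,
      ← Finset.mul_sum, Finset.sum_range_sub, hu0, hun]
    gcongr
  rw [hsum]
  calc _ ≤ _ := norm_add_le _ _
    _ ≤ _ := add_le_add hy1 hrest
    _ = _ := by rw [hC]; ring

end

section

/-! ### Variation of a bounded path that is controlled on short intervals -/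

theorem pVarReal_self {G : Type*} [NormedAddCommGroup G] {p : ℝ} (hp : 0 < p) (x : ℝ → G)
    (s : ℝ) : pVarReal p x s s = 0 := by
  refine le_antisymm (VarLE.pVarReal_le hp le_rfl fun n u hu h0 hn => ?_) (pVarReal_nonneg _ _ _ _)
  rw [Real.zero_rpow hp.ne']
  refine (Finset.sum_eq_zero fun i hi => ?_).le
  have hi := Finset.mem_range.1 hi
  have h1 : u (i + 1) = u i := by
    have := hu (Nat.zero_le i)
    have := hu (Nat.le_succ i)
    have : u (i + 1) ≤ u n := hu hi
    linarith
  rw [h1, sub_self, norm_zero, Real.zero_rpow hp.ne']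

/-- A path with increments at most `2` whose variation is at most `2 M` on all subintervals with
`M = a * length + b * |||ω|||_p ≤ 1/4` has variation at most `12 M` everywhere. A finite sequence
is cut greedily into blocks with `M ≤ 1/4`; a block together with the step after it uses up
`(1/4)^p` of the superadditive quantity `M^p`, and contributes at most `(1/2)^q + 2^q`. -/
theorem VarLE.of_local {E G : Type*} [NormedAddCommGroup E] [NormedAddCommGroup G] {p q : ℝ}
    (hp : 1 ≤ p) (hpq : p ≤ q)
    {ω : ℝ → G} {y : ℝ → E} {s t a b W V : ℝ} (ha : 0 ≤ a) (hb : 0 ≤ b) (hW0 : 0 ≤ W)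
    (hW : VarLE p ω s t W) (hV0 : 0 ≤ V) (hV : VarLE q y s t V)
    (h2 : ∀ r r', s ≤ r → r ≤ r' → r' ≤ t → ‖y r' - y r‖ ≤ 2)
    (hloc : ∀ s' t', s ≤ s' → s' ≤ t' → t' ≤ t → a * (t' - s') + b * pVarReal p ω s' t' ≤ 1 / 4 →
      pVarReal q y s' t' ≤ 2 * (a * (t' - s') + b * pVarReal p ω s' t')) :
    VarLE q y s t (12 * (a * (t - s) + b * W)) := by
  have hp0 : 0 < p := by linarith
  have hq0 : 0 < q := by linarith
  intro N u hu hu0 huN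
  set M : ℕ → ℕ → ℝ := fun i j => a * (u j - u i) + b * pVarReal p ω (u i) (u j) with hM
  have hM0 : ∀ {i j}, i ≤ j → 0 ≤ M i j := fun {i j} hij =>
    add_nonneg (mul_nonneg ha (sub_nonneg.2 (hu hij))) (mul_nonneg hb (pVarReal_nonneg _ _ _ _))
  have hsup : ∀ {i j k}, i ≤ j → j ≤ k → k ≤ N → M i j ^ p + M j k ^ p ≤ M i k ^ p := by
    intro i j k hij hjk hkN
    have hWv := (hW.mono hp0 hW0 le_rfl (hu0.trans (hu (Nat.zero_le i)))
      ((hu hkN).trans huN)).varLE_pVarReal hp0 hW0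
    have := hWv.sum_linear_add_rpow_le hp (pVarReal_nonneg _ _ _ _) ha hb (n := 2)
      (u := fun l => if l = 0 then u i else if l = 1 then u j else u k) (by
        refine monotone_nat_of_le_succ fun l => ?_
        rcases l with _ | _ | l
        · simpa using hu hij
        · simpa using hu hjk
        · simp) (by simp) (by simp)
    simpa [Finset.sum_range_succ, hM] using this
  -- sums over a block on which `M ≤ 1/4`
  have hblock : ∀ i l, i + l ≤ N → M i (i + l) ≤ 1 / 4 →
      ∑ k ∈ Finset.range l, ‖y (u (i + k + 1)) - y (u (i + k))‖ ^ q ≤ (2 * M i (i + l)) ^ q := by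
    intro i l hl hsmall
    have h1 : s ≤ u i := hu0.trans (hu (Nat.zero_le i))
    have h3 : u (i + l) ≤ t := (hu hl).trans huN
    have hv := (hV.mono hq0 hV0 le_rfl h1 h3).varLE_pVarReal hq0 hV0
    have hle := hloc _ _ h1 (hu (Nat.le_add_right i l)) h3 hsmall
    refine (hv l (fun k => u (i + k)) (fun k k' hk => hu (by omega)) (by simp) le_rfl).trans ?_
    exact Real.rpow_le_rpow (pVarReal_nonneg _ _ _ _) hle hq0.le
  have hhalf : ∀ i l, i + l ≤ N → M i (i + l) ≤ 1 / 4 →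
      ∑ k ∈ Finset.range l, ‖y (u (i + k + 1)) - y (u (i + k))‖ ^ q ≤ (1 / 2 : ℝ) ^ q := by
    intro i l hl hsmall
    refine (hblock i l hl hsmall).trans (Real.rpow_le_rpow ?_ (by linarith) hq0.le)
    have := hM0 (Nat.le_add_right i l)
    linarith
  have hquarter : ∀ {m : ℝ}, 1 / 4 < m → 1 ≤ (4 : ℝ) ^ p * m ^ p := by
    intro m hm
    rw [← Real.mul_rpow (by norm_num) (by linarith)]
    exact Real.one_le_rpow (by linarith) hp0.le
  have claim : ∀ l i, i + l ≤ N →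
      ∑ k ∈ Finset.range l, ‖y (u (i + k + 1)) - y (u (i + k))‖ ^ q ≤
        (1 / 2 : ℝ) ^ q + ((2 : ℝ) ^ q + (1 / 2 : ℝ) ^ q) * (4 ^ p * M i (i + l) ^ p) := by
    intro l
    induction l using Nat.strong_induction_on with
    | _ l ih =>
      intro i hl
      have hnn : 0 ≤ 4 ^ p * M i (i + l) ^ p :=
        mul_nonneg (by positivity) (Real.rpow_nonneg (hM0 (Nat.le_add_right i l)) _)
      by_cases hsmall : M i (i + l) ≤ 1 / 4
      · have := hhalf i l hl hsmall
        have h0 : 0 ≤ ((2 : ℝ) ^ q + (1 / 2 : ℝ) ^ q) * (4 ^ p * M i (i + l) ^ p) := by positivity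
        linarith
      · classical
        have hex : ∃ j, 1 / 4 < M i (i + j) := ⟨l, not_le.1 hsmall⟩
        obtain ⟨j, hj⟩ : ∃ j, Nat.find hex = j + 1 := by
          refine Nat.exists_eq_succ_of_ne_zero fun h0 => ?_
          have := Nat.find_spec hex
          rw [h0, add_zero] at this
          simp only [hM, sub_self, mul_zero, pVarReal_self hp0, add_zero] at this
          linarith
        have hbig : 1 / 4 < M i (i + (j + 1)) := by rw [← hj]; exact Nat.find_spec hex
        have hsm : M i (i + j) ≤ 1 / 4 := not_lt.1 (Nat.find_min hex (by omega))
        have hjl : j + 1 ≤ l := hj ▸ Nat.find_min' hex (not_le.1 hsmall)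
        obtain ⟨r, rfl⟩ : ∃ r, l = j + 1 + r := ⟨l - (j + 1), by omega⟩
        rw [Finset.sum_range_add, Finset.sum_range_succ]
        have e1 := hhalf i j (by omega) hsm
        have e2 : ‖y (u (i + j + 1)) - y (u (i + j))‖ ^ q ≤ 2 ^ q :=
          Real.rpow_le_rpow (norm_nonneg _) (h2 _ _ (hu0.trans (hu (Nat.zero_le _)))
            (hu (Nat.le_succ _)) ((hu (by omega)).trans huN)) hq0.le
        have e3 := ih r (by omega) (i + (j + 1)) (by omega)
        have e4 := hsup (Nat.le_add_right i (j + 1)) (Nat.le_add_right (i + (j + 1)) r) (by omega)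
        have e5 := hquarter hbig
        have e6 : ∀ k, i + (j + 1 + k) = i + (j + 1) + k := fun k => by ring
        simp only [e6] at hnn ⊢
        have h4p : (0 : ℝ) < 4 ^ p := by positivity
        have e7 : 4 ^ p * M i (i + (j + 1)) ^ p + 4 ^ p * M (i + (j + 1)) (i + (j + 1) + r) ^ p ≤
            4 ^ p * M i (i + (j + 1) + r) ^ p := by
          rw [← mul_add]
          exact mul_le_mul_of_nonneg_left e4 h4p.le
        have e8 : ((2 : ℝ) ^ q + (1 / 2 : ℝ) ^ q) *
            (1 + 4 ^ p * M (i + (j + 1)) (i + (j + 1) + r) ^ p) ≤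
            ((2 : ℝ) ^ q + (1 / 2 : ℝ) ^ q) * (4 ^ p * M i (i + (j + 1) + r) ^ p) :=
          mul_le_mul_of_nonneg_left (by linarith) (by positivity)
        linarith
  have hfin : M 0 N ≤ a * (t - s) + b * W := by
    have h1 := (hW.mono hp0 hW0 le_rfl hu0 huN).pVarReal_le hp0 hW0
    have h3 : u N - u 0 ≤ t - s := by linarith
    simp only [hM]
    gcongr
  have hm0 := hM0 (Nat.zero_le N)
  refine le_trans ?_ (Real.rpow_le_rpow (by positivity) (mul_le_mul_of_nonneg_left hfin
    (by norm_num : (0 : ℝ) ≤ 12)) hq0.le)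
  by_cases hsmall : M 0 N ≤ 1 / 4
  · have := hblock 0 N (by omega) (by simpa using hsmall)
    simp only [zero_add] at this
    exact this.trans (Real.rpow_le_rpow (by positivity) (by linarith) hq0.le)
  · have hbig := not_le.1 hsmall
    have h1 := claim N 0 (by omega)
    simp only [zero_add] at h1
    have h3 : (1 : ℝ) ≤ 4 ^ p * M 0 N ^ p := hquarter hbig
    have h4 : (1 : ℝ) ^ q + 2 ^ q ≤ 3 ^ q := by
      have := Real.add_rpow_le_rpow_add (zero_le_one' ℝ) (zero_le_two) (by linarith : 1 ≤ q)
      norm_num at this ⊢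
      exact this
    have h5 : (1 / 2 : ℝ) ^ q ≤ 1 / 2 := by
      have := Real.rpow_le_rpow_of_exponent_ge (by norm_num : (0 : ℝ) < 1 / 2) (by norm_num)
        (by linarith : 1 ≤ q)
      rwa [Real.rpow_one] at this
    rw [Real.one_rpow] at h4
    have h6 : (4 : ℝ) ^ p * M 0 N ^ p ≤ (4 * M 0 N) ^ q := by
      rw [← Real.mul_rpow (by norm_num) hm0]
      exact Real.rpow_le_rpow_of_exponent_le (by linarith) hpq
    calc _ ≤ _ := h1
      _ ≤ (1 / 2 : ℝ) ^ q * (4 ^ p * M 0 N ^ p) +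
          ((2 : ℝ) ^ q + (1 / 2 : ℝ) ^ q) * (4 ^ p * M 0 N ^ p) := by
        have : (0 : ℝ) ≤ (1 / 2 : ℝ) ^ q := by positivity
        nlinarith
      _ = ((2 : ℝ) ^ q + 2 * (1 / 2 : ℝ) ^ q) * (4 ^ p * M 0 N ^ p) := by ring
      _ ≤ 3 ^ q * (4 * M 0 N) ^ q := by gcongr; linarith
      _ = (12 * M 0 N) ^ q := by
        rw [← Real.mul_rpow (by norm_num) (by positivity)]
        ring_nf

/-! ### Growth of solutions of linear equations on short intervals -/

variable {E : Type*} [NormedAddCommGroup E] [InnerProductSpace ℝ E]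

theorem orthComp_clm_sub_le {y y' : E} (hy : ‖y‖ = 1) (hy' : ‖y'‖ = 1) (C C' : E →L[ℝ] E) :
    ‖orthComp y' (C' y') - orthComp y (C y)‖ ≤ ‖C' - C‖ + 3 * ‖C‖ * ‖y' - y‖ := by
  have e : orthComp y' (C' y') - orthComp y (C y) = orthComp y' ((C' - C) y') +
      orthComp y' (C (y' - y)) + (orthComp y' (C y) - orthComp y (C y)) := by
    rw [← orthComp_add]
    have : C' y' = ((C' - C) y' + C (y' - y)) + C y := by
      rw [sub_apply, map_sub]; abel
    rw [this, orthComp_add]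
    abel
  rw [e]
  have h1 := (norm_orthComp_le hy' ((C' - C) y')).trans ((C' - C).le_opNorm y')
  have h2 := (norm_orthComp_le hy' (C (y' - y))).trans (C.le_opNorm _)
  have h3 := norm_orthComp_sub_le hy hy' (C y)
  have h4 := C.le_opNorm y
  rw [hy', mul_one] at h1
  rw [hy, mul_one] at h4
  have h5 := mul_le_mul_of_nonneg_left h4 (norm_nonneg (y' - y))
  refine norm_add₃_le.trans ?_
  linarith

theorem abs_inner_clm_sub_le {y y' : E} (hy : ‖y‖ = 1) (hy' : ‖y'‖ = 1) (C C' : E →L[ℝ] E) :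
    |inner ℝ y' (C' y') - inner ℝ y (C y)| ≤ ‖C' - C‖ + 2 * ‖C‖ * ‖y' - y‖ := by
  have e : inner ℝ y' (C' y') - inner ℝ y (C y) = inner ℝ y' ((C' - C) y') +
      inner ℝ y' (C (y' - y)) + inner ℝ (y' - y) (C y) := by
    rw [sub_apply, map_sub, inner_sub_right, inner_sub_right, inner_sub_left]
    ring
  rw [e]
  have h1 := abs_real_inner_le_norm y' ((C' - C) y')
  have h2 := abs_real_inner_le_norm y' (C (y' - y))
  have h3 := abs_real_inner_le_norm (y' - y) (C y)
  have h4 := (C' - C).le_opNorm y'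
  have h5 := C.le_opNorm (y' - y)
  have h6 := C.le_opNorm y
  rw [hy', one_mul] at h1 h2
  rw [hy', mul_one] at h4
  rw [hy, mul_one] at h6
  have h7 := mul_le_mul_of_nonneg_left h6 (norm_nonneg (y' - y))
  refine (abs_add_three _ _ _).trans ?_
  linarith

theorem inv_norm_smul_orthComp (x : E) (C : E →L[ℝ] E) :
    ‖x‖⁻¹ • orthComp (direction x) (C x) = orthComp (direction x) (C (direction x)) := by
  rw [← orthComp_smul, ← map_smul, direction]

theorem inner_inv_sq_smul (x : E) (C : E →L[ℝ] E) :
    inner ℝ ((‖x‖ ^ 2)⁻¹ • x) (C x) = inner ℝ (direction x) (C (direction x)) := by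
  rw [direction, map_smul, real_inner_smul_left, real_inner_smul_left, real_inner_smul_right]
  ring

variable {p q : ℝ} {x g : ℝ → E} {C : ℝ → E →L[ℝ] E} {ω : ℝ → ℝ} {s t a c V W : ℝ}

theorem IsYoungPath.exists_varLE_direction (hq : 1 ≤ q) {z : ℝ → E}
    (hst : s ≤ t) (h : IsYoungPath p q x g z ω s t)
    (h0 : ∀ r ∈ Icc s t, x r ≠ 0) : ∃ U, 0 ≤ U ∧ VarLE q (fun r => direction (x r)) s t U := by
  obtain ⟨m, hm, hmx⟩ := exists_pos_le_norm hst h.cont h0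
  obtain ⟨U, hU0, hU⟩ := h.var
  refine ⟨2 / m * U, by positivity, hU.of_norm_sub_le_mul hq hU0 (by positivity)
    fun b b' hb hbb hb' => ?_⟩
  have hb1 : b ∈ Icc s t := ⟨hb, hbb.trans hb'⟩
  refine (YoungStability.norm_direction_sub_le (h0 b hb1)
    (h0 b' ⟨hb.trans hbb, hb'⟩)).trans ?_
  rw [div_mul_eq_mul_div]
  have := hmx b hb1
  gcongr

/-- Implicit bound for the variation of the direction `x / ‖x‖`, obtained by estimating the
noise in its equation by Young's inequality. -/
theorem IsYoungPath.pVarReal_direction_le (hp1 : 1 ≤ p) (hp2 : p < 2) (hpq : p ≤ q) (hq : 1 < q)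
    (hθ : 1 < 1 / p + 1 / q) (hst : s ≤ t)
    (h : IsYoungPath p q x g (fun r => C r (x r)) ω s t) (h0 : ∀ r ∈ Icc s t, x r ≠ 0)
    (ha : 0 ≤ a) (hga : ∀ r ∈ Icc s t, ‖g r‖ ≤ a * ‖x r‖)
    (hc : ∀ r ∈ Icc s t, ‖C r‖ ≤ c) (hV0 : 0 ≤ V) (hVc : V ≤ c) (hV : VarLE q C s t V) :
    pVarReal q (fun r => direction (x r)) s t ≤ a * (t - s) + youngK p q * c *
      (2 + 3 * pVarReal q (fun r => direction (x r)) s t) * pVarReal p ω s t := by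
  have hp0 : 0 < p := by linarith
  have hq0 : 0 < q := by linarith
  have hc0 : 0 ≤ c := hV0.trans hVc
  have hK := one_le_youngK hθ
  obtain ⟨W, hW0, hW⟩ := h.var_driver
  obtain ⟨U, hU0, hU⟩ := h.exists_varLE_direction hq.le hst h0
  have hY0 := pVarReal_nonneg q (fun r => direction (x r)) s t
  have hY := hU.varLE_pVarReal hq0 hU0
  have hw := hW.varLE_pVarReal hp0 hW0
  set Y := pVarReal q (fun r => direction (x r)) s t with hYdef
  have hw0 := pVarReal_nonneg p ω s t
  have hD : VarLE q (fun r => ‖x r‖⁻¹ • orthComp (direction (x r)) (C r (x r))) s t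
      (1 * V + 3 * c * Y) := by
    refine hV.of_norm_sub_le hq.le hY hV0 hY0 zero_le_one (by positivity) fun b b' hb hbb hb' => ?_
    have hb1 : b ∈ Icc s t := ⟨hb, hbb.trans hb'⟩
    have hb2 : b' ∈ Icc s t := ⟨hb.trans hbb, hb'⟩
    rw [inv_norm_smul_orthComp, inv_norm_smul_orthComp, one_mul]
    refine (orthComp_clm_sub_le (norm_direction (h0 b hb1)) (norm_direction (h0 b' hb2)) _ _).trans
      ?_
    have := hc b hb1
    gcongr
  have hinc : ∀ b b', s ≤ b → b ≤ b' → b' ≤ t → ‖direction (x b') - direction (x b)‖ ≤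
      a * (b' - b) + youngK p q * c * (2 + 3 * Y) * pVarReal p ω b b' := by
    intro b b' hb hbb hb'
    have hb1 : b ∈ Icc s t := ⟨hb, hbb.trans hb'⟩
    have hwb := pVarReal_nonneg p ω b b'
    have hD0 : 0 ≤ 1 * V + 3 * c * Y := by positivity
    refine ((h.mono hp0 hq0 hb hbb hb').norm_direction_sub_le hp1 hp2 hq hθ hbb
      (fun r hr => h0 r ⟨hb.trans hr.1, hr.2.trans hb'⟩) ha
      (fun r hr => hga r ⟨hb.trans hr.1, hr.2.trans hb'⟩) hwb hD0
      ((hW.mono hp0 hW0 le_rfl hb hb').varLE_pVarReal hp0 hW0)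
      (hD.mono hq0 hD0 le_rfl hb hb') (c := c) ?_).trans ?_
    · rw [inv_norm_smul_orthComp]
      refine (norm_orthComp_le (norm_direction (h0 b hb1)) _).trans (((C b).le_opNorm _).trans ?_)
      rw [norm_direction (h0 b hb1), mul_one]
      exact hc b hb1
    · have e1 : c + youngK p q * (1 * V + 3 * c * Y) ≤ youngK p q * c * (2 + 3 * Y) := by
        have e2 : c ≤ youngK p q * c := le_mul_of_one_le_left hc0 hK
        have e3 : youngK p q * V ≤ youngK p q * c := by gcongr
        linarith
      rw [mul_comm _ (pVarReal p ω b b')]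
      gcongr
  have hβ : 0 ≤ youngK p q * c * (2 + 3 * Y) := by positivity
  have hR0 : 0 ≤ a * (t - s) + youngK p q * c * (2 + 3 * Y) * pVarReal p ω s t :=
    add_nonneg (mul_nonneg ha (sub_nonneg.2 hst)) (by positivity)
  refine VarLE.pVarReal_le hq0 hR0 fun n u hu hu0 hun => ?_
  refine sum_rpow_le_rpow_of_le _ hp0 hpq hR0 (fun _ _ => norm_nonneg _) (le_trans
    (Finset.sum_le_sum fun i hi => ?_) (hw.sum_linear_add_rpow_le hp1 hw0 ha hβ hu hu0 hun))
  exact Real.rpow_le_rpow (norm_nonneg _) (hinc _ _ (hu0.trans (hu (Nat.zero_le i)))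
    (hu (Nat.le_succ i)) ((hu (Finset.mem_range.1 hi)).trans hun)) hp0.le

theorem IsYoungPath.varLE_direction (hp1 : 1 ≤ p) (hp2 : p < 2) (hpq : p ≤ q) (hq : 1 < q)
    (hθ : 1 < 1 / p + 1 / q) (hst : s ≤ t)
    (h : IsYoungPath p q x g (fun r => C r (x r)) ω s t) (h0 : ∀ r ∈ Icc s t, x r ≠ 0)
    (ha : 0 ≤ a) (hga : ∀ r ∈ Icc s t, ‖g r‖ ≤ a * ‖x r‖)
    (hc : ∀ r ∈ Icc s t, ‖C r‖ ≤ c) (hV0 : 0 ≤ V) (hVc : V ≤ c) (hV : VarLE q C s t V)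
    (hW0 : 0 ≤ W) (hW : VarLE p ω s t W) :
    VarLE q (fun r => direction (x r)) s t
      (12 * (a * (t - s) + 2 * youngK p q * c * W)) := by
  have hp0 : 0 < p := by linarith
  have hq0 : 0 < q := by linarith
  have hc0 : 0 ≤ c := hV0.trans hVc
  have hK := one_le_youngK hθ
  obtain ⟨U, hU0, hU⟩ := h.exists_varLE_direction hq.le hst h0
  refine VarLE.of_local hp1 hpq ha (by positivity) hW0 hW hU0 hU (fun r r' hr hrr hr' => ?_)
    fun s' t' hs' hst' ht' hsmall => ?_
  · refine (norm_sub_le _ _).trans ?_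
    rw [norm_direction (h0 r ⟨hr, hrr.trans hr'⟩), norm_direction (h0 r' ⟨hr.trans hrr, hr'⟩)]
    norm_num
  · have hsub : ∀ r ∈ Icc s' t', r ∈ Icc s t := fun r hr => ⟨hs'.trans hr.1, hr.2.trans ht'⟩
    have := (h.mono hp0 hq0 hs' hst' ht').pVarReal_direction_le hp1 hp2 hpq hq hθ hst'
      (fun r hr => h0 r (hsub r hr)) ha (fun r hr => hga r (hsub r hr))
      (fun r hr => hc r (hsub r hr)) hV0 hVc (hV.mono hq0 hV0 le_rfl hs' ht')
    set Y := pVarReal q (fun r => direction (x r)) s' t'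
    set w := pVarReal p ω s' t'
    have hY0 : 0 ≤ Y := pVarReal_nonneg _ _ _ _
    have hd : 0 ≤ a * (t' - s') := mul_nonneg ha (sub_nonneg.2 hst')
    -- the implicit bound reads `Y ≤ M + 3/2 * b w * Y` with `b w ≤ M ≤ 1/4`
    have hb : 2 * youngK p q * c * w * Y ≤ 1 / 4 * Y :=
      mul_le_mul_of_nonneg_right (by linarith) hY0
    linarith

/-- Growth of `‖x‖` over an interval of length at most one, for `dx = g dt + C x dω` with
`⟪x, g⟫ ≤ κ ‖x‖²` and `‖g‖ ≤ a ‖x‖`. -/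
theorem IsYoungPath.log_norm_sub_le_of_linear [CompleteSpace E] (hp1 : 1 ≤ p) (hp2 : p < 2)
    (hpq : p ≤ q) (hq : 1 < q)
    (hθ : 1 < 1 / p + 1 / q) (hst : s ≤ t) (hts : t - s ≤ 1)
    (h : IsYoungPath p q x g (fun r => C r (x r)) ω s t) (h0 : ∀ r ∈ Icc s t, x r ≠ 0)
    {κ : ℝ → ℝ} (hκ : IntervalIntegrable κ volume s t)
    (hgκ : ∀ r ∈ Icc s t, inner ℝ (x r) (g r) ≤ κ r * ‖x r‖ ^ 2)
    (ha : 0 ≤ a) (hga : ∀ r ∈ Icc s t, ‖g r‖ ≤ a * ‖x r‖)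
    (hc : ∀ r ∈ Icc s t, ‖C r‖ ≤ c) (hV0 : 0 ≤ V) (hVc : V ≤ c) (hV : VarLE q C s t V)
    (hW0 : 0 ≤ W) (hW : VarLE p ω s t W) :
    Real.log ‖x t‖ - Real.log ‖x s‖ ≤ (∫ r in s..t, κ r) +
      W * (‖C s‖ + youngK p q * (V + 24 * c * (a + 2 * youngK p q * c * W))) := by
  have hc0 : 0 ≤ c := hV0.trans hVc
  have hK := one_le_youngK hθ
  have hq0 : 0 < q := by linarith
  have hY := h.varLE_direction hp1 hp2 hpq hq hθ hst h0 ha hga hc hV0 hVc hV hW0 hW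
  have hY0 : 0 ≤ 12 * (a * (t - s) + 2 * youngK p q * c * W) := by
    have : 0 ≤ t - s := sub_nonneg.2 hst
    positivity
  have hζ : VarLE q (fun r => inner ℝ ((‖x r‖ ^ 2)⁻¹ • x r) (C r (x r))) s t
      (1 * V + 2 * c * (12 * (a * (t - s) + 2 * youngK p q * c * W))) := by
    refine hV.of_norm_sub_le hq.le hY hV0 hY0 zero_le_one (by positivity) fun b b' hb hbb hb' => ?_
    have hb1 : b ∈ Icc s t := ⟨hb, hbb.trans hb'⟩
    have hb2 : b' ∈ Icc s t := ⟨hb.trans hbb, hb'⟩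
    rw [inner_inv_sq_smul, inner_inv_sq_smul, one_mul, Real.norm_eq_abs]
    refine (abs_inner_clm_sub_le (norm_direction (h0 b hb1)) (norm_direction (h0 b' hb2)) _ _).trans
      ?_
    have := hc b hb1
    gcongr
  have hs : s ∈ Icc s t := left_mem_Icc.2 hst
  refine (h.log_norm_sub_le hp1 hp2 hq hθ hst h0 hκ hgκ hW0 (by positivity) hW hζ (e := ‖C s‖)
    ?_).trans ?_
  · rw [inner_inv_sq_smul]
    refine (abs_real_inner_le_norm _ _).trans ?_
    have := (C s).le_opNorm (direction (x s))
    rwa [norm_direction (h0 s hs), one_mul, ← mul_one ‖C s‖, ← norm_direction (h0 s hs)]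
  · have e1 : a * (t - s) ≤ a := mul_le_of_le_one_right ha hts
    have e2 : 1 * V + 2 * c * (12 * (a * (t - s) + 2 * youngK p q * c * W)) ≤
        V + 24 * c * (a + 2 * youngK p q * c * W) := by
      have := mul_le_mul_of_nonneg_left e1 hc0
      nlinarith
    gcongr

end

section

/-! ### Solutions of the Young equation -/

theorem LocFinPVar.exists_varLE {E : Type*} [NormedAddCommGroup E] {p : ℝ} (hp : 0 < p)
    {x : ℝ → E} (h : LocFinPVar p x) {s t : ℝ} (hs : 0 ≤ s) : ∃ V, 0 ≤ V ∧ VarLE p x s t V :=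
  ⟨pVarReal p x 0 (max t 1), pVarReal_nonneg _ _ _ _,
    (varLE_pVarReal hp (h.2 _ (lt_max_of_lt_right one_pos))).mono hp (pVarReal_nonneg _ _ _ _)
      le_rfl hs (le_max_left _ _)⟩

theorem LocFinPVar.varLE_pVarReal {E : Type*} [NormedAddCommGroup E] {p : ℝ} (hp : 0 < p)
    {x : ℝ → E} (h : LocFinPVar p x) {s t : ℝ} (hs : 0 ≤ s) :
    VarLE p x s t (pVarReal p x s t) :=
  let ⟨_, h0, hV⟩ := h.exists_varLE hp hs
  VarLE.varLE_pVarReal hp h0 hV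

theorem Icc_subset_Ici_zero {s t : ℝ} (hs : 0 ≤ s) : Icc s t ⊆ Ici 0 := fun _ hr => hs.trans hr.1

variable {d : ℕ} {p q : ℝ} {ω : ℝ → ℝ} {A C : ℝ → Mat d} {F : ℝ → Vec d → Vec d} {f h : ℝ → ℝ}
  {x : ℝ → Vec d} {s t : ℝ}

theorem norm_drift_le (hF0 : ∀ t, 0 ≤ t → F t 0 = 0)
    (hFf : ∀ t, 0 ≤ t → ∀ x y : Vec d, ‖F t x - F t y‖ ≤ f t * ‖x - y‖) {r : ℝ} (hr : 0 ≤ r)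
    (v : Vec d) : ‖A r v + F r v‖ ≤ (‖A r‖ + f r) * ‖v‖ := by
  have h1 := (A r).le_opNorm v
  have h2 := hFf r hr v 0
  rw [hF0 r hr, sub_zero, sub_zero] at h2
  refine (norm_add_le _ _).trans ?_
  linarith

theorem inner_drift_le (hAh : ∀ t, 0 ≤ t → ∀ x : Vec d, inner ℝ x (A t x) ≤ -h t * ‖x‖ ^ 2)
    (hF0 : ∀ t, 0 ≤ t → F t 0 = 0)
    (hFf : ∀ t, 0 ≤ t → ∀ x y : Vec d, ‖F t x - F t y‖ ≤ f t * ‖x - y‖) {r : ℝ} (hr : 0 ≤ r)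
    (v : Vec d) : inner ℝ v (A r v + F r v) ≤ (f r - h r) * ‖v‖ ^ 2 := by
  have h1 := hAh r hr v
  have h2 := hFf r hr v 0
  rw [hF0 r hr, sub_zero, sub_zero] at h2
  have h3 := real_inner_le_norm v (F r v)
  have h4 := mul_le_mul_of_nonneg_left h2 (norm_nonneg v)
  rw [inner_add_right]
  nlinarith

theorem IsSolution.isYoungPath (hp : 0 < p) (hq : 1 ≤ q)
    (hω : LocFinPVar p ω) (hA : ContinuousOn A (Ici 0)) (hC : LocFinPVar q C)
    (hf_cont : ContinuousOn f (Ici 0)) (hf_nonneg : ∀ t, 0 ≤ t → 0 ≤ f t)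
    (hF0 : ∀ t, 0 ≤ t → F t 0 = 0)
    (hFf : ∀ t, 0 ≤ t → ∀ x y : Vec d, ‖F t x - F t y‖ ≤ f t * ‖x - y‖)
    (hx : IsSolution q A F C ω x) (hs : 0 ≤ s) (hst : s ≤ t) :
    IsYoungPath p q x (fun r => A r (x r) + F r (x r)) (fun r => C r (x r)) ω s t := by
  have hq0 : 0 < q := by linarith
  have hsub : Icc s t ⊆ Ici 0 := Icc_subset_Ici_zero hs
  obtain ⟨X, hX⟩ := isCompact_Icc.exists_bound_of_continuousOn (hx.finPVar.1.mono hsub)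
  obtain ⟨c, hc⟩ := isCompact_Icc.exists_bound_of_continuousOn (hC.1.mono hsub)
  have hX0 : 0 ≤ X := (norm_nonneg _).trans (hX s (left_mem_Icc.2 hst))
  have hc0 : 0 ≤ c := (norm_nonneg _).trans (hc s (left_mem_Icc.2 hst))
  have hint : ∀ a b, 0 ≤ a → a ≤ b →
      IntervalIntegrable (fun r => A r (x r) + F r (x r)) volume a b :=
    fun a b ha hab => (hx.integrable b (ha.trans hab)).mono_set (by
      rw [uIcc_of_le hab, uIcc_of_le (ha.trans hab)]; exact Icc_subset_Icc_left ha)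
  refine ⟨hx.finPVar.1.mono hsub, hω.1.mono hsub, hω.exists_varLE hp hs,
    hx.finPVar.exists_varLE hq0 hs, ?_, hint s t hs hst, ?_, ?_⟩
  · obtain ⟨U, hU0, hU⟩ := hx.finPVar.exists_varLE (t := t) hq0 hs
    obtain ⟨V, hV0, hV⟩ := hC.exists_varLE (t := t) hq0 hs
    refine ⟨X * V + c * U, by positivity, hV.of_norm_sub_le hq hU hV0 hU0 hX0 hc0
      fun a b ha hab hb => ?_⟩
    have e : C b (x b) - C a (x a) = (C b - C a) (x b) + C a (x b - x a) := by
      rw [sub_apply, map_sub]; abel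
    rw [e]
    have h1 := (C b - C a).le_opNorm (x b)
    have h2 := (C a).le_opNorm (x b - x a)
    have h3 := mul_le_mul_of_nonneg_left (hX b ⟨ha.trans hab, hb⟩) (norm_nonneg (C b - C a))
    have h4 := mul_le_mul_of_nonneg_right (hc a ⟨ha, hab.trans hb⟩) (norm_nonneg (x b - x a))
    refine (norm_add_le _ _).trans ?_
    linarith
  · obtain ⟨a, ha⟩ := isCompact_Icc.exists_bound_of_continuousOn (hA.mono hsub)
    obtain ⟨φ, hφ⟩ := isCompact_Icc.exists_bound_of_continuousOn (hf_cont.mono hsub)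
    have ha0 : 0 ≤ a := (norm_nonneg _).trans (ha s (left_mem_Icc.2 hst))
    have hφ0 : 0 ≤ φ := (norm_nonneg _).trans (hφ s (left_mem_Icc.2 hst))
    refine ⟨(a + φ) * X, by positivity, fun r hr => (norm_drift_le hF0 hFf (hsub hr) _).trans ?_⟩
    have h1 := ha r hr
    have h2 := (Real.le_norm_self _).trans (hφ r hr)
    have h3 := hX r hr
    have h4 := hf_nonneg r (hsub hr)
    gcongr
  · intro a b ha hab hb
    have ha0 := hs.trans ha
    have hI := (hx.equation a ha0).sub (hx.equation b (ha0.trans hab)) ha0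
    have e := intervalIntegral.integral_add_adjacent_intervals (hint 0 a le_rfl ha0)
      (hint a b ha0 hab)
    convert hI using 1
    rw [← e]
    abel

/-- The sum `‖A‖_∞ + ‖f‖_∞` over `[k, k + 1]` as a real number. -/
def driftBound (A : ℝ → Mat d) (f : ℝ → ℝ) (k : ℕ) : ℝ :=
  (supNorm A (unitIvl k) + supNorm f (unitIvl k)).toReal

/-- The `q`-variation norm of `C` over `[k, k + 1]` as a real number. -/
def noiseBound (q : ℝ) (C : ℝ → Mat d) (k : ℕ) : ℝ := ‖C k‖ + pVarReal q C k (k + 1)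

/-- The `p`-variation seminorm of `ω` over `[k, k + 1]` as a real number. -/
def driverBound (p : ℝ) (ω : ℝ → ℝ) (k : ℕ) : ℝ := pVarReal p ω k (k + 1)

/-- Bound for the contribution of the noise to the growth of `log ‖x‖` over `[k, k + 1]`. -/
def growthBound (p q : ℝ) (A : ℝ → Mat d) (f : ℝ → ℝ) (C : ℝ → Mat d) (ω : ℝ → ℝ) (k : ℕ) : ℝ :=
  youngK p q * noiseBound q C k * driverBound p ω k *
    (1 + 32 * driftBound A f k + 64 * youngK p q * noiseBound q C k * driverBound p ω k)

theorem driftBound_nonneg (A : ℝ → Mat d) (f : ℝ → ℝ) (k : ℕ) : 0 ≤ driftBound A f k :=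
  ENNReal.toReal_nonneg

theorem noiseBound_nonneg (q : ℝ) (C : ℝ → Mat d) (k : ℕ) : 0 ≤ noiseBound q C k :=
  add_nonneg (norm_nonneg _) (pVarReal_nonneg _ _ _ _)

theorem driverBound_nonneg (p : ℝ) (ω : ℝ → ℝ) (k : ℕ) : 0 ≤ driverBound p ω k :=
  pVarReal_nonneg _ _ _ _

theorem growthBound_nonneg (hθ : 1 < 1 / p + 1 / q) (A : ℝ → Mat d) (f : ℝ → ℝ) (C : ℝ → Mat d)
    (ω : ℝ → ℝ) (k : ℕ) : 0 ≤ growthBound p q A f C ω k := by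
  have h1 := one_le_youngK hθ
  have h2 := driftBound_nonneg A f k
  have h3 := noiseBound_nonneg q C k
  have h4 := driverBound_nonneg p ω k
  unfold growthBound
  positivity

theorem supNorm_unitIvl_lt_top {E : Type*} [NormedAddCommGroup E] {x : ℝ → E}
    (hx : ContinuousOn x (Ici 0)) (k : ℕ) : supNorm x (unitIvl k) < ∞ := by
  obtain ⟨c, hc⟩ := (isCompact_Icc (a := (k : ℝ)) (b := (k : ℝ) + 1)).exists_bound_of_continuousOn
    (hx.mono (Icc_subset_Ici_zero (Nat.cast_nonneg k)))
  refine lt_of_le_of_lt (iSup₂_le fun r hr => ?_) (ENNReal.ofReal_lt_top (r := c))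
  rw [← ofReal_norm]
  exact ENNReal.ofReal_le_ofReal (hc r hr)

theorem ofReal_driftBound (hA : ContinuousOn A (Ici 0)) (hf : ContinuousOn f (Ici 0)) (k : ℕ) :
    ENNReal.ofReal (driftBound A f k) = supNorm A (unitIvl k) + supNorm f (unitIvl k) :=
  ENNReal.ofReal_toReal (ENNReal.add_lt_top.2
    ⟨supNorm_unitIvl_lt_top hA k, supNorm_unitIvl_lt_top hf k⟩).ne

theorem norm_add_le_driftBound (hA : ContinuousOn A (Ici 0)) (hf : ContinuousOn f (Ici 0))
    (hf_nonneg : ∀ t, 0 ≤ t → 0 ≤ f t) {k : ℕ} {r : ℝ} (hr : r ∈ Icc (k : ℝ) (k + 1)) :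
    ‖A r‖ + f r ≤ driftBound A f k := by
  rw [← ENNReal.ofReal_le_ofReal_iff (driftBound_nonneg A f k), ofReal_driftBound hA hf,
    ENNReal.ofReal_add (norm_nonneg _) (hf_nonneg r ((Nat.cast_nonneg k).trans hr.1)), ofReal_norm]
  refine add_le_add (le_iSup₂_of_le (f := fun t (_ : t ∈ unitIvl k) => ‖A t‖ₑ) r hr le_rfl)
    (le_iSup₂_of_le (f := fun t (_ : t ∈ unitIvl k) => ‖f t‖ₑ) r hr ?_)
  rw [← ofReal_norm]
  exact ENNReal.ofReal_le_ofReal (Real.le_norm_self _)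

theorem norm_le_noiseBound (hq : 0 < q) (hC : LocFinPVar q C) {k : ℕ} {r : ℝ}
    (hr : r ∈ Icc (k : ℝ) (k + 1)) : ‖C r‖ ≤ noiseBound q C k := by
  have h1 := (hC.varLE_pVarReal (t := k + 1) hq (Nat.cast_nonneg k)).norm_sub_le hq
    (pVarReal_nonneg _ _ _ _) le_rfl hr.1 hr.2
  have h2 := norm_sub_norm_le (C r) (C k)
  unfold noiseBound
  linarith

theorem ofReal_driverBound (hp : 0 < p) (hω : LocFinPVar p ω) (k : ℕ) :
    ENNReal.ofReal (driverBound p ω k) = pVar p ω (unitIvl k) := by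
  refine ENNReal.ofReal_toReal (ne_top_of_le_ne_top ENNReal.ofReal_ne_top
    ((pVar_le_ofReal_iff hp (pVarReal_nonneg p ω k (k + 1))).2
      (hω.varLE_pVarReal hp (Nat.cast_nonneg k))))

theorem ofReal_noiseBound (hq : 0 < q) (hC : LocFinPVar q C) (k : ℕ) :
    ENNReal.ofReal (noiseBound q C k) = pVarNorm q C k (k + 1) := by
  rw [noiseBound, pVarNorm, ENNReal.ofReal_add (norm_nonneg _) (pVarReal_nonneg _ _ _ _),
    ofReal_norm, pVarReal, ENNReal.ofReal_toReal (ne_top_of_le_ne_top ENNReal.ofReal_ne_top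
    ((pVar_le_ofReal_iff hq (pVarReal_nonneg q C k (k + 1))).2
      (hC.varLE_pVarReal hq (Nat.cast_nonneg k))))]

/-- The standing assumptions on the coefficients and on the driver. -/
structure IsAdmissible (p q : ℝ) (ω : ℝ → ℝ) (A C : ℝ → Mat d) (F : ℝ → Vec d → Vec d)
    (h f : ℝ → ℝ) : Prop where
  one_lt_p : 1 < p
  p_lt_two : p < 2
  p_le_q : p ≤ q
  one_lt_theta : 1 < 1 / p + 1 / q
  driver : LocFinPVar p ω
  cont_drift : ContinuousOn A (Ici 0)
  noise : LocFinPVar q C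
  h_nonneg : ∀ t, 0 ≤ t → 0 ≤ h t
  h_integrable : ∀ t, 0 ≤ t → IntervalIntegrable h volume 0 t
  dissipative : ∀ t, 0 ≤ t → ∀ x : Vec d, inner ℝ x (A t x) ≤ -h t * ‖x‖ ^ 2
  f_nonneg : ∀ t, 0 ≤ t → 0 ≤ f t
  cont_f : ContinuousOn f (Ici 0)
  map_zero : ∀ t, 0 ≤ t → F t 0 = 0
  lipschitz : ∀ t, 0 ≤ t → ∀ x y : Vec d, ‖F t x - F t y‖ ≤ f t * ‖x - y‖

theorem IsAdmissible.integrable_sub (H : IsAdmissible p q ω A C F h f) (hs : 0 ≤ s)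
    (hst : s ≤ t) : IntervalIntegrable (fun r => f r - h r) volume s t := by
  have h1 : IntervalIntegrable f volume s t :=
    (H.cont_f.mono (by rw [uIcc_of_le hst]; exact Icc_subset_Ici_zero hs)).intervalIntegrable
  refine h1.sub ((H.h_integrable t (hs.trans hst)).mono_set ?_)
  rw [uIcc_of_le hst, uIcc_of_le (hs.trans hst)]
  exact Icc_subset_Icc_left hs

theorem IsAdmissible.log_norm_sub_le (H : IsAdmissible p q ω A C F h f)
    (hx : IsSolution q A F C ω x) {k : ℕ} (hs : (k : ℝ) ≤ s) (hst : s ≤ t)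
    (ht : t ≤ (k : ℝ) + 1) (h0 : ∀ r ∈ Icc s t, x r ≠ 0) :
    Real.log ‖x t‖ - Real.log ‖x s‖ ≤ (∫ r in s..t, (f r - h r)) +
      driverBound p ω k * (‖C s‖ + youngK p q * (pVarReal q C k (k + 1) + 24 * noiseBound q C k *
        (driftBound A f k + 2 * youngK p q * noiseBound q C k * driverBound p ω k))) := by
  have hp0 : 0 < p := by linarith [H.one_lt_p]
  have hq : 1 < q := H.one_lt_p.trans_le H.p_le_q
  have hq0 : 0 < q := by linarith
  have hk : (0 : ℝ) ≤ k := Nat.cast_nonneg k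
  have hs0 := hk.trans hs
  have hsub : ∀ r ∈ Icc s t, r ∈ Icc (k : ℝ) (k + 1) := fun r hr => ⟨hs.trans hr.1, hr.2.trans ht⟩
  refine (hx.isYoungPath hp0 hq.le H.driver H.cont_drift H.noise H.cont_f H.f_nonneg H.map_zero
    H.lipschitz hs0 hst).log_norm_sub_le_of_linear H.one_lt_p.le H.p_lt_two H.p_le_q hq
    H.one_lt_theta hst (by linarith) h0 (H.integrable_sub hs0 hst)
    (fun r hr => inner_drift_le H.dissipative H.map_zero H.lipschitz (hk.trans (hsub r hr).1) _)
    (driftBound_nonneg A f k) (fun r hr => ?_)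
    (fun r hr => norm_le_noiseBound hq0 H.noise (hsub r hr))
    (pVarReal_nonneg _ _ _ _) (le_add_of_nonneg_left (norm_nonneg _))
    ((H.noise.varLE_pVarReal hq0 hk).mono hq0 (pVarReal_nonneg _ _ _ _) le_rfl hs ht)
    (driverBound_nonneg p ω k)
    ((H.driver.varLE_pVarReal hp0 hk).mono hp0 (pVarReal_nonneg _ _ _ _) le_rfl hs ht)
  refine (norm_drift_le H.map_zero H.lipschitz (hk.trans (hsub r hr).1) _).trans ?_
  have := norm_add_le_driftBound H.cont_drift H.cont_f H.f_nonneg (hsub r hr)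
  gcongr

/-- A solution that does not vanish at time `t` did not vanish before: after a last zero the
bound for `log ‖x t‖ - log ‖x s‖` would remain finite as `s` decreases to the zero. -/
theorem IsAdmissible.ne_zero (H : IsAdmissible p q ω A C F h f)
    (hx : IsSolution q A F C ω x) (hxt : x t ≠ 0) : ∀ r ∈ Icc 0 t, x r ≠ 0 := by
  by_contra! hcon
  obtain ⟨r₀, hr₀, hxr₀⟩ := hcon
  have hcont : ContinuousOn x (Icc 0 t) := hx.finPVar.1.mono (Icc_subset_Ici_zero le_rfl)
  set Z := Icc 0 t ∩ x ⁻¹' {0} with hZ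
  have hZc : IsCompact Z :=
    isCompact_Icc.of_isClosed_subset (hcont.preimage_isClosed_of_isClosed isClosed_Icc
      isClosed_singleton) inter_subset_left
  obtain ⟨σ, ⟨hσ, hxσ⟩, hmax⟩ := hZc.exists_isGreatest ⟨r₀, hr₀, hxr₀⟩
  have hxσ : x σ = 0 := hxσ
  have hσt : σ < t := lt_of_le_of_ne hσ.2 fun he => hxt (he ▸ hxσ)
  set k := ⌊σ⌋₊ with hk
  have hkσ : (k : ℝ) ≤ σ := Nat.floor_le hσ.1
  set τ := min t (k + 1) with hτ
  have hστ : σ < τ := lt_min hσt (Nat.lt_floor_add_one σ)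
  have hne : ∀ r, σ < r → r ≤ t → x r ≠ 0 := fun r h1 h2 h3 =>
    absurd (hmax ⟨⟨hσ.1.trans h1.le, h2⟩, h3⟩) (not_le.2 h1)
  have hτt : τ ≤ t := min_le_left _ _
  have hτk : τ ≤ k + 1 := min_le_right _ _
  have hq0 : 0 < q := by linarith [H.one_lt_p, H.p_le_q]
  have hK : 0 ≤ youngK p q := zero_le_one.trans (one_le_youngK H.one_lt_theta)
  have hk0 : (0 : ℝ) ≤ k := Nat.cast_nonneg k
  set M := driftBound A f k + driverBound p ω k * (noiseBound q C k + youngK p q *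
    (pVarReal q C k (k + 1) + 24 * noiseBound q C k *
        (driftBound A f k + 2 * youngK p q * noiseBound q C k * driverBound p ω k))) with hM
  have hlow : ∀ s, σ < s → s ≤ τ → Real.exp (Real.log ‖x τ‖ - M) ≤ ‖x s‖ := by
    intro s hs hsτ
    have hks : (k : ℝ) ≤ s := hkσ.trans hs.le
    have hxs := norm_pos_iff.2 (hne s hs (hsτ.trans hτt))
    rw [← Real.le_log_iff_exp_le hxs]
    have h1 := H.log_norm_sub_le hx hks hsτ hτk
      fun r hr => hne r (hs.trans_le hr.1) (hr.2.trans hτt)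
    have h2 : (∫ r in s..τ, (f r - h r)) ≤ driftBound A f k := by
      have h3 : (∫ r in s..τ, (f r - h r)) ≤ ∫ _ in s..τ, driftBound A f k := by
        refine intervalIntegral.integral_mono_on hsτ (H.integrable_sub (hk0.trans hks) hsτ)
          intervalIntegrable_const fun r hr => ?_
        have h4 := norm_add_le_driftBound H.cont_drift H.cont_f H.f_nonneg (k := k) (r := r)
          ⟨hks.trans hr.1, hr.2.trans hτk⟩
        have h5 := H.h_nonneg r (hk0.trans (hks.trans hr.1))
        have h6 := norm_nonneg (A r)
        linarith
      rw [intervalIntegral.integral_const, smul_eq_mul] at h3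
      refine h3.trans (mul_le_of_le_one_left (driftBound_nonneg A f k) (by linarith))
    have h3 : ‖C s‖ ≤ noiseBound q C k :=
      norm_le_noiseBound hq0 H.noise ⟨hks, hsτ.trans hτk⟩
    have h4 := mul_le_mul_of_nonneg_left h3 (driverBound_nonneg p ω k)
    rw [hM]
    linarith
  set η := Real.exp (Real.log ‖x τ‖ - M) with hη
  have hη0 : 0 < η := Real.exp_pos _
  obtain ⟨δ, hδ, hosc⟩ := exists_le_of_continuousOn_Icc hcont (half_pos hη0)
  have hmin : 0 < min (δ / 2) (τ - σ) := lt_min (by positivity) (by linarith)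
  have h1 := hlow (σ + min (δ / 2) (τ - σ)) (by linarith)
    (by linarith [min_le_right (δ / 2) (τ - σ)])
  have h2 := hosc σ (σ + min (δ / 2) (τ - σ)) hσ.1 (by linarith)
    (by linarith [min_le_right (δ / 2) (τ - σ)]) (by linarith [min_le_left (δ / 2) (τ - σ)])
  rw [hxσ, sub_zero] at h2
  linarith

theorem IsAdmissible.log_norm_sub_le_sum (H : IsAdmissible p q ω A C F h f)
    (hx : IsSolution q A F C ω x) (N : ℕ) : ∀ t : ℝ, 0 ≤ t → t ≤ N → x t ≠ 0 →
    Real.log ‖x t‖ - Real.log ‖x 0‖ ≤ (∫ r in (0 : ℝ)..t, (f r - h r)) +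
      ∑ k ∈ Finset.range N, growthBound p q A f C ω k := by
  induction N with
  | zero =>
    intro t ht0 ht _
    have : t = 0 := le_antisymm (by simpa using ht) ht0
    simp [this]
  | succ N ih =>
    intro t ht0 ht hxt
    have hne := H.ne_zero hx hxt
    rw [Finset.sum_range_succ]
    rcases le_or_gt t N with htN | htN
    · have := ih t ht0 htN hxt
      have := growthBound_nonneg H.one_lt_theta A f C ω N
      linarith
    · have hN0 : (0 : ℝ) ≤ N := Nat.cast_nonneg N
      have h1 := ih N hN0 le_rfl (hne N ⟨hN0, htN.le⟩)
      have h2 := H.log_norm_sub_le hx (le_refl (N : ℝ)) htN.le (by exact_mod_cast ht)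
        fun r hr => hne r ⟨hN0.trans hr.1, hr.2⟩
      have h3 := intervalIntegral.integral_add_adjacent_intervals
        (H.integrable_sub le_rfl hN0) (H.integrable_sub hN0 htN.le)
      have hK := one_le_youngK H.one_lt_theta
      have ha := driftBound_nonneg A f N
      have hc := noiseBound_nonneg q C N
      have hW := driverBound_nonneg p ω N
      have h4 : ‖C N‖ + youngK p q * pVarReal q C N (N + 1) ≤ youngK p q * noiseBound q C N := by
        rw [noiseBound, mul_add]
        have := le_mul_of_one_le_left (norm_nonneg (C N)) hK
        linarith
      have h5 : driverBound p ω N * (‖C N‖ + youngK p q * (pVarReal q C N (N + 1) +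
          24 * noiseBound q C N * (driftBound A f N +
            2 * youngK p q * noiseBound q C N * driverBound p ω N))) ≤
          growthBound p q A f C ω N := by
        have h6 := mul_le_mul_of_nonneg_left h4 hW
        have h7 : 0 ≤ youngK p q * noiseBound q C N * driverBound p ω N *
            (8 * driftBound A f N + 16 * youngK p q * noiseBound q C N * driverBound p ω N) := by
          positivity
        unfold growthBound
        nlinarith
      linarith

end

section

/-! ### Averages of powers -/

/-- The power mean `((1/(m+1)) ∑_{k ≤ m} (a k)^r)^(1/r)`. -/
def powerMean (r : ℝ) (a : ℕ → ℝ≥0∞) (m : ℕ) : ℝ≥0∞ :=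
  ((∑ k ∈ Finset.range (m + 1), a k ^ r) / ((m : ℝ≥0∞) + 1)) ^ (1 / r)

theorem limsupMean_eq (r : ℝ) (a : ℕ → ℝ≥0∞) : limsupMean r a = limsup (powerMean r a) atTop := rfl

theorem powerMean_one (a : ℕ → ℝ≥0∞) (m : ℕ) :
    powerMean 1 a m = (∑ k ∈ Finset.range (m + 1), a k) / ((m : ℝ≥0∞) + 1) := by
  simp [powerMean]

theorem powerMean_mul_le {r : ℝ} (hr : 0 < r) (a b : ℕ → ℝ≥0∞) (m : ℕ) :
    powerMean r (fun k => a k * b k) m ≤ powerMean (2 * r) a m * powerMean (2 * r) b m := by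
  have hcs := ENNReal.inner_le_Lp_mul_Lq (Finset.range (m + 1)) (fun k => a k ^ r)
    (fun k => b k ^ r) (p := 2) (q := 2) Real.HolderConjugate.two_two
  have e : ∀ x : ℝ≥0∞, (x ^ r) ^ (2 : ℝ) = x ^ (2 * r) := fun x => by
    rw [← ENNReal.rpow_mul, mul_comm]
  simp only [e] at hcs
  have hn : ∀ n : ℝ≥0∞, n = n ^ (1 / 2 : ℝ) * n ^ (1 / 2 : ℝ) := fun n => by
    rw [← ENNReal.rpow_add_of_nonneg _ _ (by norm_num) (by norm_num)]
    norm_num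
  have e2 : ∀ x : ℝ≥0∞, (x ^ (1 / 2 : ℝ)) ^ (1 / r) = x ^ (1 / (2 * r)) := fun x => by
    rw [← ENNReal.rpow_mul]
    congr 1
    field_simp
  have hr' : 0 ≤ 1 / r := by positivity
  unfold powerMean
  generalize (m : ℝ≥0∞) + 1 = n
  rw [← e2, ← e2, ← ENNReal.mul_rpow_of_nonneg _ _ hr']
  refine ENNReal.rpow_le_rpow ?_ hr'
  simp only [div_eq_mul_inv _ n, ENNReal.mul_rpow_of_nonneg _ _ hr.le]
  rw [ENNReal.mul_rpow_of_nonneg _ _ (by norm_num), ENNReal.mul_rpow_of_nonneg _ _ (by norm_num),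
    mul_mul_mul_comm, ← hn n⁻¹]
  gcongr

theorem powerMean_le_powerMean {r r' : ℝ} (hr : 0 < r) (hrr : r ≤ r') (a : ℕ → ℝ≥0∞) (m : ℕ) :
    powerMean r a m ≤ powerMean r' a m := by
  have hr' : 0 < r' := hr.trans_le hrr
  set n : ℝ≥0∞ := (m : ℝ≥0∞) + 1
  have hw : ∑ _k ∈ Finset.range (m + 1), n⁻¹ = 1 := by
    rw [Finset.sum_const, Finset.card_range, nsmul_eq_mul, Nat.cast_add, Nat.cast_one]
    exact ENNReal.mul_inv_cancel (by simp) (by simp)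
  have h := ENNReal.rpow_arith_mean_le_arith_mean_rpow (Finset.range (m + 1)) (fun _ => n⁻¹)
    (fun k => a k ^ r) hw (p := r' / r) ((one_le_div hr).2 hrr)
  have e : ∀ x : ℝ≥0∞, (x ^ r) ^ (r' / r) = x ^ r' := fun x => by
    rw [← ENNReal.rpow_mul, mul_div_cancel₀ _ hr.ne']
  simp only [e] at h
  rw [← Finset.mul_sum, ← Finset.mul_sum, mul_comm n⁻¹, mul_comm n⁻¹, ← div_eq_mul_inv,
    ← div_eq_mul_inv] at h
  have h2 := ENNReal.rpow_le_rpow h (show 0 ≤ 1 / r' by positivity)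
  rw [← ENNReal.rpow_mul] at h2
  rwa [show r' / r * (1 / r') = 1 / r by field_simp] at h2

theorem limsupMean_le_limsupMean {r r' : ℝ} (hr : 0 < r) (hrr : r ≤ r') (a : ℕ → ℝ≥0∞) :
    limsupMean r a ≤ limsupMean r' a :=
  limsup_le_limsup (Eventually.of_forall fun m => powerMean_le_powerMean hr hrr a m)

theorem limsupMean_mul_le {r : ℝ} (hr : 0 < r) {a b : ℕ → ℝ≥0∞} (ha : limsupMean (2 * r) a ≠ ∞)
    (hb : limsupMean (2 * r) b ≠ ∞) :
    limsupMean r (fun k => a k * b k) ≤ limsupMean (2 * r) a * limsupMean (2 * r) b :=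
  (limsup_le_limsup (Eventually.of_forall fun m => powerMean_mul_le hr a b m)).trans
    (ENNReal.limsup_mul_le' (Or.inr hb) (Or.inl ha))

theorem limsupMean_one_add_le (a b : ℕ → ℝ≥0∞) :
    limsupMean 1 (fun k => a k + b k) ≤ limsupMean 1 a + limsupMean 1 b := by
  refine ENNReal.le_of_forall_pos_le_add fun ε hε hlt => ?_
  obtain ⟨ha, hb⟩ := ENNReal.add_lt_top.1 hlt
  have hε2 : ((ε : ℝ≥0∞) / 2) ≠ 0 := by simpa using hε.ne'
  have h1 := eventually_lt_of_limsup_lt (f := atTop) (u := powerMean 1 a)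
    (ENNReal.lt_add_right ha.ne hε2)
  have h2 := eventually_lt_of_limsup_lt (f := atTop) (u := powerMean 1 b)
    (ENNReal.lt_add_right hb.ne hε2)
  refine limsup_le_of_le (by isBoundedDefault) ?_
  filter_upwards [h1, h2] with m h1 h2
  have e : powerMean 1 (fun k => a k + b k) m = powerMean 1 a m + powerMean 1 b m := by
    simp only [powerMean_one, Finset.sum_add_distrib, ENNReal.add_div]
  calc _ = _ := e
    _ ≤ (limsupMean 1 a + ε / 2) + (limsupMean 1 b + ε / 2) := add_le_add h1.le h2.le
    _ = limsupMean 1 a + limsupMean 1 b + (ε / 2 + ε / 2) := by ring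
    _ = _ := by rw [ENNReal.add_halves]

theorem limsupMean_one_const_mul (c : ℝ≥0∞) (hc : c ≠ ∞) (a : ℕ → ℝ≥0∞) :
    limsupMean 1 (fun k => c * a k) = c * limsupMean 1 a := by
  rw [limsupMean_eq, limsupMean_eq, ← ENNReal.limsup_const_mul_of_ne_top hc]
  congr 1
  funext m
  simp only [powerMean_one, ← Finset.mul_sum, mul_div_assoc]

variable {d : ℕ} {p q : ℝ} {ω : ℝ → ℝ} {A C : ℝ → Mat d} {F : ℝ → Vec d → Vec d} {f h : ℝ → ℝ}

/-- The mean growth caused by the noise: Hölder's inequality separates the three factors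
`‖C‖`, `‖A‖ + ‖f‖` and `|||ω|||` of its bound on unit intervals. -/
theorem IsAdmissible.limsupMean_growthBound_le (H : IsAdmissible p q ω A C F h f)
    (hA_fin : hatA p A f < ∞) (hC_fin : hatC p q C < ∞) (hω_fin : Gam p ω (2 * p + 2) < ∞) :
    limsupMean 1 (fun k => ENNReal.ofReal (growthBound p q A f C ω k)) ≤
      ENNReal.ofReal (youngK p q) * (1 + 4 * hatG p (youngK p q) (hatA p A f) (hatC p q C)) *
        hatC p q C * (Gam p ω 2 + Gam p ω 4 ^ 2 + Gam p ω (2 * p + 2) ^ (p + 1)) := by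
  have hp1 := H.one_lt_p
  have hp0 : 0 < p := by linarith
  have hq0 : 0 < q := hp0.trans_le H.p_le_q
  have hK0 : 0 ≤ youngK p q := zero_le_one.trans (one_le_youngK H.one_lt_theta)
  set κ := ENNReal.ofReal (youngK p q) with hκ
  have hκtop : κ ≠ ∞ := ENNReal.ofReal_ne_top
  set a : ℕ → ℝ≥0∞ := fun k => supNorm A (unitIvl k) + supNorm f (unitIvl k) with ha
  set c : ℕ → ℝ≥0∞ := fun k => pVarNorm q C (k : ℝ) ((k : ℝ) + 1) with hc
  set w : ℕ → ℝ≥0∞ := fun k => pVar p ω (unitIvl k) with hw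
  have hgrowth : ∀ k, ENNReal.ofReal (growthBound p q A f C ω k) =
      κ * (c k * w k) + (32 * κ * (c k * a k * w k) +
        64 * κ * κ * (c k * w k * (c k * w k))) := by
    intro k
    have h1 := driftBound_nonneg A f k
    have h2 := noiseBound_nonneg q C k
    have h3 := driverBound_nonneg p ω k
    have e : growthBound p q A f C ω k = youngK p q * (noiseBound q C k * driverBound p ω k) +
        (32 * youngK p q * (noiseBound q C k * driftBound A f k * driverBound p ω k) +
        64 * youngK p q * youngK p q * (noiseBound q C k * driverBound p ω k *
          (noiseBound q C k * driverBound p ω k))) := by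
      unfold growthBound; ring
    rw [e, ENNReal.ofReal_add (by positivity) (by positivity),
      ENNReal.ofReal_add (by positivity) (by positivity),
      ENNReal.ofReal_mul (p := 64 * youngK p q * youngK p q) (by positivity),
      ENNReal.ofReal_mul (p := noiseBound q C k * driverBound p ω k) (by positivity)]
    simp only [ENNReal.ofReal_mul, hK0, h1, h2, mul_nonneg, Nat.ofNat_nonneg,
      ENNReal.ofReal_ofNat, ofReal_driftBound H.cont_drift H.cont_f,
      ofReal_noiseBound hq0 H.noise, ofReal_driverBound hp0 H.driver]
    rfl
  set Ah := hatA p A f with hAh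
  set Ch := hatC p q C with hCh
  have hc4 : limsupMean 4 c ≤ Ch := limsupMean_le_limsupMean (by norm_num) (by linarith) c
  have hc2 : limsupMean 2 c ≤ Ch := limsupMean_le_limsupMean (by norm_num) (by linarith) c
  have ha4 : limsupMean 4 a ≤ Ah := limsupMean_le_limsupMean (by norm_num) (by linarith) a
  have hw4 : Gam p ω 4 ≠ ∞ := ne_top_of_le_ne_top hω_fin.ne
    (limsupMean_le_limsupMean (by norm_num) (by linarith) w)
  have hw2 : Gam p ω 2 ≠ ∞ := ne_top_of_le_ne_top hω_fin.ne
    (limsupMean_le_limsupMean (by norm_num) (by linarith) w)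
  have hc4t := ne_top_of_le_ne_top hC_fin.ne hc4
  have hc2t := ne_top_of_le_ne_top hC_fin.ne hc2
  have ha4t := ne_top_of_le_ne_top hA_fin.ne ha4
  have mul_one_le : ∀ {u v : ℕ → ℝ≥0∞} {U V : ℝ≥0∞}, limsupMean 2 u ≤ U → limsupMean 2 v ≤ V →
      U ≠ ∞ → V ≠ ∞ → limsupMean 1 (fun k => u k * v k) ≤ U * V := by
    intro u v U V hu hv hU hV
    have := limsupMean_mul_le one_pos (a := u) (b := v)
    rw [mul_one] at this
    exact (this (ne_top_of_le_ne_top hU hu) (ne_top_of_le_ne_top hV hv)).trans (mul_le_mul' hu hv)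
  have mul_two_le : ∀ {u v : ℕ → ℝ≥0∞} {U V : ℝ≥0∞}, limsupMean 4 u ≤ U → limsupMean 4 v ≤ V →
      U ≠ ∞ → V ≠ ∞ → limsupMean 2 (fun k => u k * v k) ≤ U * V := by
    intro u v U V hu hv hU hV
    have := limsupMean_mul_le two_pos (a := u) (b := v)
    rw [show (2 : ℝ) * 2 = 4 by norm_num] at this
    exact (this (ne_top_of_le_ne_top hU hu) (ne_top_of_le_ne_top hV hv)).trans (mul_le_mul' hu hv)
  have m1 : limsupMean 1 (fun k => c k * w k) ≤ Ch * Gam p ω 2 :=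
    mul_one_le hc2 le_rfl hC_fin.ne hw2
  have m2 : limsupMean 1 (fun k => c k * a k * w k) ≤ Ch * Ah * Gam p ω 2 :=
    mul_one_le (mul_two_le hc4 ha4 hC_fin.ne hA_fin.ne) le_rfl
      (ENNReal.mul_ne_top hC_fin.ne hA_fin.ne) hw2
  have m3' : limsupMean 2 (fun k => c k * w k) ≤ Ch * Gam p ω 4 :=
    mul_two_le hc4 le_rfl hC_fin.ne hw4
  have m3 : limsupMean 1 (fun k => c k * w k * (c k * w k)) ≤
      Ch * Gam p ω 4 * (Ch * Gam p ω 4) :=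
    mul_one_le m3' m3' (ENNReal.mul_ne_top hC_fin.ne hw4) (ENNReal.mul_ne_top hC_fin.ne hw4)
  set G := hatG p (youngK p q) Ah Ch with hG
  have g1 : 8 * Ah ≤ G := (le_max_left _ _).trans (le_max_left _ _)
  have g2 : 16 * κ * Ch ≤ G := (le_max_right _ _).trans (le_max_left _ _)
  simp only [hgrowth]
  calc _ ≤ κ * (Ch * Gam p ω 2) + (32 * κ * (Ch * Ah * Gam p ω 2) +
        64 * κ * κ * (Ch * Gam p ω 4 * (Ch * Gam p ω 4))) := by
        refine (limsupMean_one_add_le _ _).trans (add_le_add ?_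
          ((limsupMean_one_add_le _ _).trans (add_le_add ?_ ?_)))
        · rw [limsupMean_one_const_mul _ hκtop]
          gcongr
        · rw [limsupMean_one_const_mul _ (ENNReal.mul_ne_top (by norm_num) hκtop)]
          gcongr
        · rw [limsupMean_one_const_mul _
            (ENNReal.mul_ne_top (ENNReal.mul_ne_top (by norm_num) hκtop) hκtop)]
          gcongr
    _ = κ * Ch * Gam p ω 2 + 4 * (8 * Ah) * (κ * Ch * Gam p ω 2) +
        4 * (16 * κ * Ch) * (κ * Ch * Gam p ω 4 ^ 2) := by ring
    _ ≤ κ * Ch * Gam p ω 2 + 4 * G * (κ * Ch * Gam p ω 2) +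
        4 * G * (κ * Ch * Gam p ω 4 ^ 2) := by gcongr
    _ ≤ κ * Ch * Gam p ω 2 + 4 * G * (κ * Ch * Gam p ω 2) +
        4 * G * (κ * Ch * Gam p ω 4 ^ 2) + (κ * Ch * Gam p ω 4 ^ 2 +
          κ * (1 + 4 * G) * Ch * Gam p ω (2 * p + 2) ^ (p + 1)) := le_self_add
    _ = _ := by ring

/-! ### Exponential decay of all solutions -/

theorem exists_sum_le_of_limsupMean_lt {b : ℕ → ℝ} (hb : ∀ k, 0 ≤ b k) {c : ℝ}
    (h : limsupMean 1 (fun k => ENNReal.ofReal (b k)) < ENNReal.ofReal c) :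
    ∃ β, 0 ≤ β ∧ β < c ∧ ∀ᶠ m : ℕ in atTop, ∑ k ∈ Finset.range (m + 1), b k ≤ β * (m + 1) := by
  obtain ⟨β, h1, h2⟩ := exists_between h
  have hβ : β ≠ ∞ := (h2.trans_le le_top).ne
  refine ⟨β.toReal, ENNReal.toReal_nonneg, (ENNReal.lt_ofReal_iff_toReal_lt hβ).1 h2, ?_⟩
  filter_upwards [eventually_lt_of_limsup_lt h1] with m hm
  change powerMean 1 _ m < β at hm
  rw [powerMean_one, ← ENNReal.ofReal_sum_of_nonneg fun k _ => hb k,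
    ENNReal.div_lt_iff (by simp) (by simp)] at hm
  have h3 : β * ((m : ℝ≥0∞) + 1) = ENNReal.ofReal (β.toReal * (m + 1)) := by
    rw [ENNReal.ofReal_mul ENNReal.toReal_nonneg, ENNReal.ofReal_toReal hβ,
      ENNReal.ofReal_add (by positivity) zero_le_one, ENNReal.ofReal_natCast, ENNReal.ofReal_one]
  rw [h3] at hm
  exact (ENNReal.ofReal_le_ofReal_iff (mul_nonneg ENNReal.toReal_nonneg (by positivity))).1 hm.le

theorem IsAdmissible.exists_norm_le_exp (H : IsAdmissible p q ω A C F h f) {h₀ : ℝ}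
    (hdecay : (h₀ : EReal) ≤
      liminf (fun t : ℝ => ((1 / t * ∫ s in (0 : ℝ)..t, (h s - f s) : ℝ) : EReal)) atTop)
    (hgrowth : limsupMean 1 (fun k => ENNReal.ofReal (growthBound p q A f C ω k)) <
      ENNReal.ofReal h₀) :
    ∃ M > 0, ∃ μ > 0, ∀ x : ℝ → Vec d, IsSolution q A F C ω x →
      ∀ t, 0 ≤ t → ‖x t‖ ≤ M * ‖x 0‖ * Real.exp (-μ * t) := by
  have hb0 := growthBound_nonneg H.one_lt_theta A f C ω
  obtain ⟨β, hβ0, hβ, hsum⟩ := exists_sum_le_of_limsupMean_lt hb0 hgrowth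
  set μ := (h₀ - β) / 2 with hμ
  have hμ0 : 0 < μ := by rw [hμ]; linarith
  have hlim : ((h₀ - μ : ℝ) : EReal) < liminf (fun t : ℝ =>
      ((1 / t * ∫ s in (0 : ℝ)..t, (h s - f s) : ℝ) : EReal)) atTop :=
    lt_of_lt_of_le (by exact_mod_cast (by linarith : h₀ - μ < h₀)) hdecay
  have hint : ∀ t, ∫ s in (0 : ℝ)..t, (f s - h s) = -∫ s in (0 : ℝ)..t, (h s - f s) := fun t => by
    rw [← intervalIntegral.integral_neg]
    simp
  obtain ⟨T₁, hT₁⟩ := eventually_atTop.1 (eventually_lt_of_lt_liminf hlim)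
  obtain ⟨m₀, hm₀⟩ := eventually_atTop.1 hsum
  set T := max (max T₁ 1) m₀ with hT
  have hT0 : 0 < T := lt_max_of_lt_left (lt_max_of_lt_right one_pos)
  -- an upper bound for the exponent on `[0, T]`, where no decay is available yet
  obtain ⟨φ, hφ⟩ := (isCompact_Icc (a := (0 : ℝ)) (b := T)).exists_bound_of_continuousOn
    (H.cont_f.mono (Icc_subset_Ici_zero le_rfl))
  have hφ0 : 0 ≤ φ := (norm_nonneg _).trans (hφ 0 (left_mem_Icc.2 hT0.le))
  set S := ∑ k ∈ Finset.range ⌈T⌉₊, growthBound p q A f C ω k with hS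
  have hS0 : 0 ≤ S := Finset.sum_nonneg fun k _ => hb0 k
  set L := φ * T + S + μ * T + β with hL
  refine ⟨Real.exp L, Real.exp_pos _, μ, hμ0, fun x hx t ht => ?_⟩
  by_cases hxt : x t = 0
  · rw [hxt, norm_zero]
    positivity
  have hx0 := H.ne_zero hx hxt 0 (left_mem_Icc.2 ht)
  suffices hlog : Real.log ‖x t‖ - Real.log ‖x 0‖ ≤ L - μ * t by
    have h1 : Real.log ‖x t‖ ≤ L + Real.log ‖x 0‖ + -μ * t := by linarith
    have h2 := (Real.log_le_iff_le_exp (norm_pos_iff.2 hxt)).1 h1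
    rwa [Real.exp_add, Real.exp_add, Real.exp_log (norm_pos_iff.2 hx0)] at h2
  rcases le_or_gt t T with htT | htT
  · have h1 := H.log_norm_sub_le_sum hx ⌈T⌉₊ t ht (htT.trans (Nat.le_ceil T)) hxt
    have h2 : (∫ r in (0 : ℝ)..t, (f r - h r)) ≤ ∫ _ in (0 : ℝ)..t, φ := by
      refine intervalIntegral.integral_mono_on ht (H.integrable_sub le_rfl ht)
        intervalIntegrable_const fun r hr => ?_
      have h3 := (Real.le_norm_self _).trans (hφ r ⟨hr.1, hr.2.trans htT⟩)
      have h4 := H.h_nonneg r hr.1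
      linarith
    rw [intervalIntegral.integral_const, smul_eq_mul, sub_zero] at h2
    have h3 : t * φ ≤ φ * T := by rw [mul_comm]; gcongr
    have h4 : μ * t ≤ μ * T := by gcongr
    linarith
  · have hTt : T₁ ≤ t := ((le_max_left _ _).trans (le_max_left _ _)).trans htT.le
    have ht1 : 0 < t := hT0.trans htT
    have h1 := H.log_norm_sub_le_sum hx (⌊t⌋₊ + 1) t ht
      (by push_cast; exact (Nat.lt_floor_add_one t).le) hxt
    have h2 := hm₀ ⌊t⌋₊ (Nat.le_floor ((le_max_right _ _).trans htT.le))
    have h3 : β * ((⌊t⌋₊ : ℝ) + 1) ≤ β * (t + 1) := by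
      have := Nat.floor_le ht
      gcongr
    have h4 : h₀ - μ < 1 / t * ∫ s in (0 : ℝ)..t, (h s - f s) := by exact_mod_cast hT₁ t hTt
    rw [one_div, ← div_eq_inv_mul, lt_div_iff₀ ht1] at h4
    rw [hint] at h1
    have h5 : (h₀ - μ) * t = β * t + μ * t := by rw [hμ]; ring
    have h6 : 0 ≤ φ * T := by positivity
    have h7 : 0 ≤ μ * T := by positivity
    linarith

theorem isSolution_zero (hp : 0 < q) (hF0 : ∀ t, 0 ≤ t → F t 0 = 0) :
    IsSolution q A F C ω (fun _ => 0) := by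
  have hdrift : ∀ r, 0 ≤ r → A r 0 + F r 0 = 0 := fun r hr => by rw [map_zero, hF0 r hr, add_zero]
  refine ⟨⟨continuousOn_const, fun T _ => ?_⟩, fun t ht => ?_, fun t ht => ?_⟩
  · refine lt_of_le_of_lt ((pVar_le_ofReal_iff hp le_rfl).2 fun n u _ _ _ => ?_)
      ENNReal.ofReal_lt_top
    simp [Real.zero_rpow hp.ne']
  · refine (intervalIntegrable_const (c := (0 : Vec d))).congr fun r hr => ?_
    rw [uIoc_of_le ht] at hr
    exact (hdrift r hr.1.le).symm
  · have h0 : ∫ s in (0 : ℝ)..t, (A s 0 + F s 0) = 0 := by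
      rw [intervalIntegral.integral_congr (g := fun _ => (0 : Vec d)) fun r hr => ?_]
      · simp
      · rw [uIcc_of_le ht] at hr
        exact hdrift r hr.1
    simp only [map_zero, zero_add] at h0
    intro ε hε
    exact ⟨1, one_pos, fun n u _ _ _ _ => by simpa [h0] using hε⟩

theorem limsup_log_neg {E : Type*} [NormedAddCommGroup E] {x : ℝ → E} {B μ : ℝ} (hμ : 0 < μ)
    (hx : ∀ t, 0 ≤ t → ‖x t‖ ≤ B * Real.exp (-μ * t)) :
    limsup (fun t : ℝ => ((1 / t : ℝ) : EReal) * ENNReal.log ‖x t‖ₑ) atTop < 0 := by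
  have hlim : Tendsto (fun t : ℝ => B * Real.exp (-(μ / 2 * t))) atTop (nhds (B * 0)) :=
    (Real.tendsto_exp_neg_atTop_nhds_zero.comp
      (tendsto_id.const_mul_atTop (half_pos hμ))).const_mul B
  rw [mul_zero] at hlim
  refine lt_of_le_of_lt (b := ((-(μ / 2) : ℝ) : EReal)) (limsup_le_of_le (by isBoundedDefault) ?_)
    (by exact_mod_cast (by linarith : -(μ / 2) < 0))
  filter_upwards [hlim.eventually (eventually_lt_nhds one_pos), eventually_gt_atTop 0] with t h1 ht
  have h2 : ‖x t‖ ≤ Real.exp (-(μ / 2 * t)) := by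
    refine (hx t ht.le).trans ?_
    rw [show -μ * t = -(μ / 2 * t) + -(μ / 2 * t) by ring, Real.exp_add, ← mul_assoc]
    exact mul_le_of_le_one_left (Real.exp_pos _).le h1.le
  have h3 : ENNReal.log ‖x t‖ₑ ≤ ((-(μ / 2 * t) : ℝ) : EReal) := by
    rw [← ofReal_norm, ← Real.log_exp (-(μ / 2 * t)), ← ENNReal.log_ofReal_of_pos (Real.exp_pos _)]
    exact ENNReal.log_monotone (ENNReal.ofReal_le_ofReal h2)
  refine (mul_le_mul_of_nonneg_left h3 (by exact_mod_cast (by positivity : 0 ≤ 1 / t))).trans ?_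
  rw [← EReal.coe_mul]
  refine le_of_eq ?_
  congr 1
  field_simp

end

end YoungStability

end

theorem theorem3p2 (d : ℕ) (p q : ℝ) (hp1 : 1 < p) (hp2 : p < 2) (hpq : p ≤ q)
    (hθ : 1 < 1 / p + 1 / q)
    (ω : ℝ → ℝ) (hω : YoungStability.LocFinPVar p ω)
    (A : ℝ → YoungStability.Mat d) (hA : ContinuousOn A (Ici 0))
    (C : ℝ → YoungStability.Mat d) (hC : YoungStability.LocFinPVar q C)
    (F : ℝ → YoungStability.Vec d → YoungStability.Vec d)
    -- negative definiteness of `A`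
    (h : ℝ → ℝ) (hh_nonneg : ∀ t, 0 ≤ t → 0 ≤ h t)
    (hh_int : ∀ t, 0 ≤ t → IntervalIntegrable h volume 0 t)
    (hAh : ∀ t, 0 ≤ t → ∀ x : YoungStability.Vec d, inner ℝ x (A t x) ≤ -h t * ‖x‖ ^ 2)
    -- Lipschitz continuity of `F`
    (f : ℝ → ℝ) (hf_nonneg : ∀ t, 0 ≤ t → 0 ≤ f t) (hf_cont : ContinuousOn f (Ici 0))
    (hF0 : ∀ t, 0 ≤ t → F t 0 = 0)
    (hFf : ∀ t, 0 ≤ t → ∀ x y : YoungStability.Vec d, ‖F t x - F t y‖ ≤ f t * ‖x - y‖)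
    -- finiteness of the averaged norms
    (hA_fin : YoungStability.hatA p A f < ∞)
    (hC_fin : YoungStability.hatC p q C < ∞)
    (hω_fin : YoungStability.Gam p ω (2 * p + 2) < ∞)
    -- average decay rate of the drift
    (h₀ : ℝ) (hh₀ : 0 < h₀)
    (hdecay : (h₀ : EReal) ≤
      liminf (fun t : ℝ => ((1 / t * ∫ s in (0 : ℝ)..t, (h s - f s) : ℝ) : EReal)) atTop)
    -- the stability criterion
    (hcrit : ENNReal.ofReal (YoungStability.youngK p q)
        * (1 + 4 * YoungStability.hatG p (YoungStability.youngK p q)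
            (YoungStability.hatA p A f) (YoungStability.hatC p q C))
        * YoungStability.hatC p q C
        * (YoungStability.Gam p ω 2 + YoungStability.Gam p ω 4 ^ 2
            + YoungStability.Gam p ω (2 * p + 2) ^ (p + 1))
      < ENNReal.ofReal h₀) :
    YoungStability.IsExpStable q A F C ω (fun _ => 0) := by
  have H : YoungStability.IsAdmissible p q ω A C F h f :=
    ⟨hp1, hp2, hpq, hθ, hω, hA, hC, hh_nonneg, hh_int, hAh, hf_nonneg, hf_cont, hF0, hFf⟩
  obtain ⟨M, hM, μ, hμ, hdec⟩ := H.exists_norm_le_exp hdecay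
    ((H.limsupMean_growthBound_le hA_fin hC_fin hω_fin).trans_lt hcrit)
  refine ⟨⟨YoungStability.isSolution_zero (by linarith) hF0, fun ε hε => ?_⟩, 1, one_pos,
    fun x hx _ => ?_⟩
  · refine ⟨ε / (2 * M), by positivity, fun x hx hx0 => ?_⟩
    simp only [sub_zero] at hx0 ⊢
    refine lt_of_le_of_lt (iSup₂_le fun t ht => ?_)
      ((ENNReal.ofReal_lt_ofReal_iff hε).2 (half_lt_self hε))
    rw [← ofReal_norm]
    refine ENNReal.ofReal_le_ofReal ((hdec x hx t ht).trans ?_)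
    have h1 : M * ‖x 0‖ ≤ ε / 2 := by
      rw [lt_div_iff₀ (by positivity)] at hx0
      linarith
    have h2 : Real.exp (-μ * t) ≤ 1 :=
      Real.exp_le_one_iff.2 (mul_nonpos_of_nonpos_of_nonneg (by linarith) ht)
    have h3 : 0 ≤ M * ‖x 0‖ := by positivity
    exact (mul_le_of_le_one_right h3 h2).trans h1
  · simp only [sub_zero]
    exact YoungStability.limsup_log_neg hμ (hdec x hx)
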